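/- Let $d\ge 2$ be an integer and let $E$ be the set of edges of the nearest-neighbour graph on $\mathbb Z^d$. For $x=(x_e)_{e\in E}\in\mathbb R_+^E$ and $u,v\in\mathbb Z^d$ let $$d_x(u,v)=\inf_{\alpha}\sum_{e\in\alpha}x_e$$ be the first passage time, where the infimum is over all finite nearest-neighbour paths $\alpha$ from $u$ to $v$, and let $|v|=\sum_{i=1}^d|v_i|$ be the $L^1$-norm. Let $0<a<b$ be real numbers, let $p\in[0,1]$, let $\nu=(1-p)\delta_a+p\delta_b$, and let $\mu=\nu^{\otimes E}$ be the product probability measure on $\mathbb R_+^E$. Then there exist constants $C_1,C_2>0$, depending only on $d,a,b,p$, such that for every $v\in\mathbb Z^d$ with $|v|\ge 2$ the function $x\mapsto d_x(0,v)$ is $\mu$-integrable and, for every real $t>0$, $$\mu\left(\left|d_x(0,v)-\int d_y(0,v)\,d\mu(y)\right|>t\sqrt{\frac{|v|}{\log|v|}}\right)\le C_1e^{-C_2t}.$$ -/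

import Mathlib

open MeasureTheory ProbabilityTheory
open scoped NNReal

namespace FPP

/-- The `L¹`-norm `|v|` of a vertex of `ℤ^d`. -/
def l1Norm {d : ℕ} (v : Fin d → ℤ) : ℕ := ∑ i, (v i).natAbs

/-- The nearest-neighbour graph on `ℤ^d`. -/
def lattice (d : ℕ) : SimpleGraph (Fin d → ℤ) where
  Adj u v := l1Norm (u - v) = 1
  symm := ⟨fun u v h => by
    rw [← h]
    refine Finset.sum_congr rfl fun i _ => ?_
    simp only [Pi.sub_apply]
    omega⟩
  loopless := ⟨fun u h => by simp [l1Norm] at h⟩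

/-- The set `E` of (unoriented) edges of `ℤ^d`. -/
abbrev Edge (d : ℕ) : Type := (lattice d).edgeSet

/-- The time `∑_{e ∈ α} x_e` needed to go through the path `α`. -/
def pathTime {d : ℕ} (x : Edge d → ℝ≥0) {u v : Fin d → ℤ} (α : (lattice d).Walk u v) : ℝ≥0 :=
  (α.darts.map fun e => x ⟨e.edge, e.edge_mem⟩).sum

/-- The first passage time `d_x(u, v)`, the infimum of the times of the paths from `u` to `v`. -/
noncomputable def passageTime {d : ℕ} (x : Edge d → ℝ≥0) (u v : Fin d → ℤ) : ℝ :=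
  ⨅ α : (lattice d).Walk u v, (pathTime x α : ℝ)

/-- The product measure `μ = ν^{⊗ E}` on `ℝ₊^E` with `ν = (1 - p) δ_a + p δ_b`. -/
noncomputable def bernoulliFPP (d : ℕ) (a b : ℝ≥0) (p : unitInterval) :
    Measure (Edge d → ℝ≥0) :=
  Measure.infinitePi fun _ => bernoulliMeasure b a p

end FPP

/-!
The passage time is a function of finitely many independent bits. The logarithmic Sobolev
inequality on the cube, applied to a martingale decomposition (Falik and Samorodnitsky), improves
the Efron-Stein bound on the variance of a function by a factor `log r` when its influences are of
order `1 / r`. Following Benaïm and Rossignol, this is applied to `exp (t F / 2)` rather than to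
`F`: the variance of `exp (t F / 2)` controls the cumulant generating function `Λ` through
`Λ t - 2 Λ (t / 2)`, and iterating this recursion gives exponential tails.

A geodesic from `0` to `v` has at most of order `|v|` edges, which bounds the total influence, but
a single edge near `0` may have a large influence. As Benjamini, Kalai and Schramm do, the passage
time is therefore averaged over the translations by a box of side `m`, of order `|v| ^ (1 / 4)`:
this moves it by `O(m)`, well below `√(|v| / log |v|)`, while each influence becomes `O(1 / m)`, as
the translates of one edge lie in a box in which a geodesic spends a time `O(m)`.
-/

namespace FPP

section Entropy

variable {Ω : Type*} [MeasurableSpace Ω] {μ : Measure Ω}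

lemma sq_integral_mul_le {f g : Ω → ℝ} (hf : MemLp f 2 μ) (hg : MemLp g 2 μ) :
    (∫ x, f x * g x ∂μ) ^ 2 ≤ (∫ x, f x ^ 2 ∂μ) * ∫ x, g x ^ 2 ∂μ := by
  have hfg : Integrable (fun x => f x * g x) μ := hf.integrable_mul hg
  have hquad (τ : ℝ) : 0 ≤ (∫ x, g x ^ 2 ∂μ) * (τ * τ) + 2 * (∫ x, f x * g x ∂μ) * τ +
      ∫ x, f x ^ 2 ∂μ := calc
    0 ≤ ∫ x, (f x + τ * g x) ^ 2 ∂μ := integral_nonneg fun x => sq_nonneg _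
    _ = ∫ x, (τ * τ * g x ^ 2 + 2 * τ * (f x * g x) + f x ^ 2) ∂μ := by
      congr with x
      ring
    _ = _ := by
      rw [integral_add ((hg.integrable_sq.const_mul _).fun_add (hfg.const_mul _)) hf.integrable_sq,
        integral_add (hg.integrable_sq.const_mul _) (hfg.const_mul _), integral_const_mul,
        integral_const_mul]
      ring
  have := discrim_le_zero hquad
  rw [discrim] at this
  linarith

lemma sq_integral_mul_le_of_nonneg {g D : Ω → ℝ} (hD : ∀ x, 0 ≤ D x)
    (hg : AEStronglyMeasurable g μ) (hDint : Integrable D μ)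
    (hgD : Integrable (fun x => g x ^ 2 * D x) μ) :
    (∫ x, g x * D x ∂μ) ^ 2 ≤ (∫ x, g x ^ 2 * D x ∂μ) * ∫ x, D x ∂μ := by
  have hsqrt : AEStronglyMeasurable (fun x => √(D x)) μ :=
    Real.continuous_sqrt.comp_aestronglyMeasurable hDint.aestronglyMeasurable
  have hsq (x : Ω) : √(D x) ^ 2 = D x := Real.sq_sqrt (hD x)
  have h := sq_integral_mul_le (f := fun x => g x * √(D x)) (g := fun x => √(D x))
    ((memLp_two_iff_integrable_sq (hg.mul hsqrt)).2
      (by simpa only [Pi.mul_apply, mul_pow, hsq] using hgD))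
    ((memLp_two_iff_integrable_sq hsqrt).2 (by simpa only [hsq] using hDint))
  simpa only [mul_assoc, ← sq, mul_pow, hsq] using h

lemma sq_sqrt_integral_sub_sqrt_integral_le {f g : Ω → ℝ} (hf : MemLp f 2 μ) (hg : MemLp g 2 μ) :
    (√(∫ x, f x ^ 2 ∂μ) - √(∫ x, g x ^ 2 ∂μ)) ^ 2 ≤ ∫ x, (f x - g x) ^ 2 ∂μ := by
  have hfg : Integrable (fun x => f x * g x) μ := hf.integrable_mul hg
  have hexpand : ∫ x, (f x - g x) ^ 2 ∂μ =
      ∫ x, f x ^ 2 ∂μ - 2 * ∫ x, f x * g x ∂μ + ∫ x, g x ^ 2 ∂μ := by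
    simp only [sub_sq, mul_assoc]
    rw [integral_add (f := fun x => f x ^ 2 - 2 * (f x * g x))
        (hf.integrable_sq.sub (hfg.const_mul 2)) hg.integrable_sq,
      integral_sub hf.integrable_sq (hfg.const_mul 2), integral_const_mul]
  have hf0 : 0 ≤ ∫ x, f x ^ 2 ∂μ := integral_nonneg fun x => sq_nonneg _
  have hg0 : 0 ≤ ∫ x, g x ^ 2 ∂μ := integral_nonneg fun x => sq_nonneg _
  have hCS : ∫ x, f x * g x ∂μ ≤ √(∫ x, f x ^ 2 ∂μ) * √(∫ x, g x ^ 2 ∂μ) := by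
    rw [← Real.sqrt_mul hf0]
    exact Real.le_sqrt_of_sq_le (sq_integral_mul_le hf hg)
  rw [hexpand, sub_sq, Real.sq_sqrt hf0, Real.sq_sqrt hg0]
  linarith

/-- The entropy `∫ f log f - (∫ f) log (∫ f)` of a nonnegative function. -/
noncomputable def entropy (f : Ω → ℝ) (μ : Measure Ω) : ℝ :=
  ∫ x, f x * Real.log (f x) ∂μ - (∫ x, f x ∂μ) * Real.log (∫ x, f x ∂μ)

lemma two_mul_sq_mul_one_add_log_sub_le {c : ℝ} (hc : 0 < c) (x : ℝ) :
    2 * x ^ 2 * (1 + Real.log c) - 2 * c * |x| ≤ x ^ 2 * Real.log (x ^ 2) := by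
  rcases eq_or_ne x 0 with rfl | hx
  · simp
  have hx : 0 < |x| := abs_pos.2 hx
  have hlog : 1 - c / |x| ≤ Real.log |x| - Real.log c := by
    simpa [Real.log_div hx.ne' hc.ne'] using Real.one_sub_inv_le_log_of_pos (div_pos hx hc)
  have hmul : |x| ^ 2 * (1 - c / |x|) = |x| ^ 2 - c * |x| := by field_simp
  rw [← sq_abs x, Real.log_pow]
  have := mul_le_mul_of_nonneg_left hlog (sq_nonneg |x|)
  push_cast
  linarith

/- The pointwise bound is applied with the scale `c = √(l ∫ V²)`. -/
lemma integral_sq_mul_one_add_log_sub_le_entropy {V : Ω → ℝ} [IsFiniteMeasure μ]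
    (hV : MemLp V 2 μ) (hVlog : Integrable (fun x => V x ^ 2 * Real.log (V x ^ 2)) μ)
    {l : ℝ} (hl : 0 < l) :
    (∫ x, V x ^ 2 ∂μ) * (1 + Real.log l) - l * (∫ x, |V x| ∂μ) ^ 2 ≤
      entropy (fun x => V x ^ 2) μ := by
  have hw0 : 0 ≤ ∫ x, V x ^ 2 ∂μ := integral_nonneg fun x => sq_nonneg _
  rcases hw0.eq_or_lt with hw | hw
  · have hV0 : V =ᵐ[μ] 0 := by
      filter_upwards [(integral_eq_zero_iff_of_nonneg (fun x => sq_nonneg (V x))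
        hV.integrable_sq).1 hw.symm] with x hx
      simpa using hx
    have habs : ∫ x, |V x| ∂μ = 0 :=
      integral_eq_zero_of_ae (by filter_upwards [hV0] with x hx; simp [hx])
    have hlog : ∫ x, V x ^ 2 * Real.log (V x ^ 2) ∂μ = 0 :=
      integral_eq_zero_of_ae (by filter_upwards [hV0] with x hx; simp [hx])
    simp only [entropy, ← hw, habs, hlog]
    simp
  set w := ∫ x, V x ^ 2 ∂μ
  set m := ∫ x, |V x| ∂μ
  have hVabs : Integrable (fun x => |V x|) μ := (hV.integrable one_le_two).abs
  have hint : 2 * w * (1 + Real.log √(l * w)) - 2 * √(l * w) * m ≤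
      ∫ x, V x ^ 2 * Real.log (V x ^ 2) ∂μ := by
    calc
      _ = ∫ x, (2 * V x ^ 2 * (1 + Real.log √(l * w)) - 2 * √(l * w) * |V x|) ∂μ := by
        rw [integral_sub ((hV.integrable_sq.const_mul _).mul_const _) (hVabs.const_mul _),
          integral_mul_const, integral_const_mul, integral_const_mul]
      _ ≤ _ := integral_mono
        (((hV.integrable_sq.const_mul _).mul_const _).sub (hVabs.const_mul _)) hVlog
        fun x => two_mul_sq_mul_one_add_log_sub_le (Real.sqrt_pos.2 (mul_pos hl hw)) (V x)
  have hlog : Real.log √(l * w) = (Real.log l + Real.log w) / 2 := by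
    rw [Real.log_sqrt (mul_pos hl hw).le, Real.log_mul hl.ne' hw.ne']
  have hamgm : 2 * √(l * w) * m ≤ w + l * m ^ 2 := by
    rw [Real.sqrt_mul hl.le]
    nlinarith [sq_nonneg (√w - √l * m), Real.sq_sqrt hl.le, Real.sq_sqrt hw.le]
  rw [hlog] at hint
  rw [entropy]
  linarith

end Entropy

section CumulantRecursion

variable {Ω : Type*} [MeasurableSpace Ω] {μ : Measure Ω} [IsProbabilityMeasure μ] {X : Ω → ℝ}

lemma exp_half_mul_sq (t x : ℝ) : Real.exp (t / 2 * x) ^ 2 = Real.exp (t * x) := by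
  rw [← Real.exp_nat_mul]
  push_cast
  ring_nf

lemma variance_exp_half_mul (hX : ∀ t, Integrable (fun ω => Real.exp (t * X ω)) μ) (t : ℝ) :
    Var[fun ω => Real.exp (t / 2 * X ω); μ] = mgf X μ t - mgf X μ (t / 2) ^ 2 := by
  rw [variance_eq_sub ((memLp_two_iff_integrable_sq (hX _).aestronglyMeasurable).2
    (by simpa only [exp_half_mul_sq] using hX t))]
  simp only [Pi.pow_apply, exp_half_mul_sq]
  rfl

lemma one_le_one_sub_mul_exp_two_mul {u : ℝ} (hu0 : 0 ≤ u) (hu : u ≤ 1 / 2) :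
    1 ≤ (1 - u) * Real.exp (2 * u) := by
  nlinarith [Real.add_one_le_exp (2 * u)]

lemma cgf_le_two_mul_cgf_half_add (hX : ∀ t, Integrable (fun ω => Real.exp (t * X ω)) μ)
    {u t : ℝ} (hu0 : 0 ≤ u) (hu : u ≤ 1 / 2)
    (hvar : Var[fun ω => Real.exp (t / 2 * X ω); μ] ≤ u * mgf X μ t) :
    cgf X μ t ≤ 2 * cgf X μ (t / 2) + 2 * u := by
  rw [variance_exp_half_mul hX] at hvar
  have hmgf : mgf X μ t ≤ mgf X μ (t / 2) ^ 2 * Real.exp (2 * u) := by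
    calc mgf X μ t ≤ (1 - u) * Real.exp (2 * u) * mgf X μ t :=
          le_mul_of_one_le_left mgf_nonneg (one_le_one_sub_mul_exp_two_mul hu0 hu)
      _ = (mgf X μ t - u * mgf X μ t) * Real.exp (2 * u) := by ring
      _ ≤ _ := by gcongr; linarith
  calc cgf X μ t ≤ Real.log (mgf X μ (t / 2) ^ 2 * Real.exp (2 * u)) :=
        Real.log_le_log (mgf_pos (hX t)) hmgf
    _ = 2 * cgf X μ (t / 2) + 2 * u := by
        rw [Real.log_mul (pow_ne_zero _ (mgf_pos (hX _)).ne') (Real.exp_ne_zero _),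
          Real.log_pow, Real.log_exp]
        rfl

lemma tendsto_two_pow_mul_cgf_div_two_pow
    (hX : ∀ t, Integrable (fun ω => Real.exp (t * X ω)) μ) (t : ℝ) :
    Filter.Tendsto (fun n : ℕ => 2 ^ n * cgf X μ (t / 2 ^ n)) Filter.atTop
      (nhds (t * ∫ ω, X ω ∂μ)) := by
  have hint : (0 : ℝ) ∈ interior (integrableExpSet X μ) := by
    simp [Set.eq_univ_of_forall (s := integrableExpSet X μ) hX]
  have hderiv : HasDerivAt (fun s => cgf X μ (s * t)) ((∫ ω, X ω ∂μ) * t) 0 := by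
    have h0 : HasDerivAt (cgf X μ) (∫ ω, X ω ∂μ) (0 * t) := by
      rw [zero_mul]
      simpa [deriv_cgf_zero hint] using (analyticAt_cgf hint).differentiableAt.hasDerivAt
    refine (h0.comp (h₂ := cgf X μ) (h := fun s => s * t) 0
      ((hasDerivAt_id' (0 : ℝ)).mul_const t)).congr_deriv ?_
    rw [one_mul]
  have hseq := tendsto_pow_atTop_nhdsWithin_zero_of_lt_one (𝕜 := ℝ) (r := 2⁻¹)
    (by norm_num) (by norm_num)
  rw [mul_comm t]
  refine (hderiv.tendsto_slope_zero_right.comp hseq).congr fun n => ?_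
  simp [div_eq_inv_mul]

/-- Iterating `cgf t ≤ 2 cgf (t / 2) + 2 k t²` along `t, t / 2, t / 4, …`. -/
lemma cgf_le_of_variance_exp_half_mul_le
    (hX : ∀ t, Integrable (fun ω => Real.exp (t * X ω)) μ) {k t : ℝ} (hk : 0 ≤ k)
    (hkt : k * t ^ 2 ≤ 1 / 2)
    (hvar : ∀ s, |s| ≤ |t| → Var[fun ω => Real.exp (s / 2 * X ω); μ] ≤ k * s ^ 2 * mgf X μ s) :
    cgf X μ t ≤ t * ∫ ω, X ω ∂μ + 4 * k * t ^ 2 := by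
  have hiter (n : ℕ) : cgf X μ t ≤
      2 ^ n * cgf X μ (t / 2 ^ n) + 4 * k * t ^ 2 * (1 - 1 / 2 ^ n) := by
    induction n with
    | zero => simp
    | succ n ih =>
      have hle : |t / 2 ^ n| ≤ |t| := by
        rw [abs_div, abs_of_pos (a := (2 : ℝ) ^ n) (by positivity)]
        exact div_le_self (abs_nonneg t) (one_le_pow₀ one_le_two)
      have hstep := cgf_le_two_mul_cgf_half_add hX (by positivity)
        ((mul_le_mul_of_nonneg_left (sq_le_sq.2 hle) hk).trans hkt) (hvar _ hle)
      have hhalf : t / 2 ^ n / 2 = t / 2 ^ (n + 1) := by rw [div_div, pow_succ]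
      calc cgf X μ t ≤ 2 ^ n * cgf X μ (t / 2 ^ n) + 4 * k * t ^ 2 * (1 - 1 / 2 ^ n) := ih
        _ ≤ 2 ^ n * (2 * cgf X μ (t / 2 ^ (n + 1)) + 2 * (k * (t / 2 ^ n) ^ 2)) +
            4 * k * t ^ 2 * (1 - 1 / 2 ^ n) := by
          gcongr
          rwa [hhalf] at hstep
        _ = _ := by
          field_simp
          ring
  have hbound (n : ℕ) : cgf X μ t ≤ 2 ^ n * cgf X μ (t / 2 ^ n) + 4 * k * t ^ 2 :=
    (hiter n).trans (add_le_add_right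
      (mul_le_of_le_one_right (by positivity) (sub_le_self 1 (by positivity))) _)
  exact ge_of_tendsto' ((tendsto_two_pow_mul_cgf_div_two_pow hX t).add_const _) hbound

lemma measureReal_lt_abs_sub_integral_le_two_mul_exp
    (hX : ∀ t, Integrable (fun ω => Real.exp (t * X ω)) μ) {c θ : ℝ} (hθ : 0 ≤ θ)
    (hcgf : ∀ t, |t| = θ → cgf X μ t ≤ t * (∫ ω, X ω ∂μ) + c) (u : ℝ) :
    μ.real {ω | u < |X ω - ∫ ω', X ω' ∂μ|} ≤ 2 * Real.exp (c - θ * u) := by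
  set m := ∫ ω, X ω ∂μ
  have hup : μ.real {ω | m + u ≤ X ω} ≤ Real.exp (c - θ * u) :=
    (measure_ge_le_exp_cgf (m + u) hθ (hX θ)).trans (Real.exp_le_exp.2 (by
      linarith [hcgf θ (abs_of_nonneg hθ)]))
  have hlow : μ.real {ω | X ω ≤ m - u} ≤ Real.exp (c - θ * u) :=
    (measure_le_le_exp_cgf (m - u) (neg_nonpos.2 hθ) (hX (-θ))).trans (Real.exp_le_exp.2 (by
      linarith [hcgf (-θ) (by rw [abs_neg, abs_of_nonneg hθ])]))
  have hsub : {ω | u < |X ω - m|} ⊆ {ω | m + u ≤ X ω} ∪ {ω | X ω ≤ m - u} := fun ω hω => by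
    rcases lt_abs.1 (show u < |X ω - m| from hω) with h | h
    · exact Or.inl (by simp only [Set.mem_ofPred_eq]; linarith)
    · exact Or.inr (by simp only [Set.mem_ofPred_eq]; linarith)
  linarith [measureReal_mono hsub (μ := μ), measureReal_union_le (μ := μ)
    {ω | m + u ≤ X ω} {ω | X ω ≤ m - u}]

end CumulantRecursion

lemma measureReal_lt_abs_sub_integral_le {Ω : Type*} [MeasurableSpace Ω] {μ : Measure Ω}
    [IsProbabilityMeasure μ] {f F : Ω → ℝ} (hf : Integrable f μ) (hF : Integrable F μ) {R : ℝ}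
    (h : ∀ x, |F x - f x| ≤ R) (u : ℝ) :
    μ.real {x | u < |f x - ∫ y, f y ∂μ|} ≤ μ.real {x | u - 2 * R < |F x - ∫ y, F y ∂μ|} := by
  have hmean : |∫ y, F y ∂μ - ∫ y, f y ∂μ| ≤ R := by
    rw [← integral_sub hF hf]
    simpa using norm_integral_le_of_norm_le_const (μ := μ) (f := fun x => F x - f x)
      (Filter.Eventually.of_forall h)
  refine measureReal_mono fun x (hx : u < |f x - ∫ y, f y ∂μ|) => ?_
  have htriangle : |f x - ∫ y, f y ∂μ| ≤
      |F x - ∫ y, F y ∂μ| + |F x - f x| + |∫ y, F y ∂μ - ∫ y, f y ∂μ| := by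
    rw [show f x - ∫ y, f y ∂μ = (F x - ∫ y, F y ∂μ) - (F x - f x) +
        (∫ y, F y ∂μ - ∫ y, f y ∂μ) by ring]
    exact (abs_add_le _ _).trans (add_le_add_left (abs_sub _ _) _)
  simp only [Set.mem_ofPred_eq]
  linarith [h x]

section ProductMeasure

variable {ι : Type*} {X : ι → Type*} [∀ i, MeasurableSpace (X i)]

lemma map_update_infinitePi [DecidableEq ι] (μ : ∀ i, Measure (X i))
    [∀ i, IsProbabilityMeasure (μ i)] (e : ι) :
    ((Measure.infinitePi μ).prod (μ e)).map (fun z => Function.update z.1 e z.2) =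
      Measure.infinitePi μ := by
  refine Measure.eq_infinitePi _ fun s t ht => ?_
  rw [Measure.map_apply measurable_update' (.pi s.countable_toSet fun i _ => ht i)]
  have hpre : (fun z : (∀ i, X i) × X e => Function.update z.1 e z.2) ⁻¹' ((s : Set ι).pi t) =
      (((s.erase e : Finset ι) : Set ι).pi t) ×ˢ (if e ∈ s then t e else Set.univ) := by
    ext z
    simp only [Set.mem_preimage, Set.mem_pi, Set.mem_prod, Finset.mem_coe, Finset.mem_erase]
    refine ⟨fun h => ⟨fun i hi => by simpa [Function.update_of_ne hi.1] using h i hi.2, ?_⟩,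
      fun ⟨hne, he⟩ i hi => ?_⟩
    · split_ifs with he
      · simpa using h e he
      · trivial
    · obtain rfl | hie := eq_or_ne i e
      · simpa [hi] using he
      · simpa [Function.update_of_ne hie] using hne i ⟨hie, hi⟩
  rw [hpre, Measure.prod_prod, Measure.infinitePi_pi _ fun i _ => ht i]
  split_ifs with he
  · rw [mul_comm, Finset.mul_prod_erase s (fun i => μ i (t i)) he]
  · rw [Finset.erase_eq_of_notMem he, measure_univ, mul_one]

end ProductMeasure

section Cube

variable {ι : Type*} {p : unitInterval}

/-- The Bernoulli product measure on the discrete cube, with density `p` of `true`. -/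
noncomputable def cubeMeasure (ι : Type*) (p : unitInterval) : Measure (ι → Bool) :=
  Measure.infinitePi fun _ => bernoulliMeasure true false p

instance : IsProbabilityMeasure (cubeMeasure ι p) := by
  unfold cubeMeasure
  infer_instance

lemma map_comp_equiv_cubeMeasure {κ : Type*} (σ : ι ≃ κ) :
    (cubeMeasure κ p).map (fun x i => x (σ i)) = cubeMeasure ι p := by
  rw [cubeMeasure, cubeMeasure]
  convert Measure.infinitePi_map_piCongrLeft (fun _ : ι => bernoulliMeasure true false p) σ.symm
    using 2
  ext x i
  simpa using
    (MeasurableEquiv.piCongrLeft_apply_apply (β := fun _ : ι => Bool) σ.symm x (σ i)).symm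

variable [DecidableEq ι]

/-- The increment of `g` when the coordinate `e` is switched from `false` to `true`. -/
def discDeriv (e : ι) (g : (ι → Bool) → ℝ) (x : ι → Bool) : ℝ :=
  g (Function.update x e true) - g (Function.update x e false)

/-- The average of `g` over the coordinate `e`, that is, the conditional expectation of `g` given
all the other coordinates. -/
noncomputable def resample (p : unitInterval) (e : ι) (g : (ι → Bool) → ℝ) (x : ι → Bool) : ℝ :=
  (1 - p) * g (Function.update x e false) + p * g (Function.update x e true)

lemma integral_resample (e : ι) {g : (ι → Bool) → ℝ} (hg : Integrable g (cubeMeasure ι p)) :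
    ∫ x, resample p e g x ∂(cubeMeasure ι p) = ∫ x, g x ∂(cubeMeasure ι p) := by
  have hmap : ((cubeMeasure ι p).prod (bernoulliMeasure true false p)).map
      (fun z => Function.update z.1 e z.2) = cubeMeasure ι p :=
    map_update_infinitePi (fun _ => bernoulliMeasure true false p) e
  rw [← hmap] at hg
  have hint : Integrable (fun z : (ι → Bool) × Bool => g (Function.update z.1 e z.2))
      ((cubeMeasure ι p).prod (bernoulliMeasure true false p)) :=
    hg.comp_measurable measurable_update'
  conv_rhs => rw [← hmap]
  rw [integral_map measurable_update'.aemeasurable hg.aestronglyMeasurable, integral_prod _ hint]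
  refine integral_congr_ae (Filter.Eventually.of_forall fun x => ?_)
  simp only [integral_bernoulliMeasure, smul_eq_mul, resample]
  ring

lemma integral_mul_sub_update_true (e : ι) {g F : (ι → Bool) → ℝ}
    (h : Integrable (fun x => g x * (F (Function.update x e true) - F x)) (cubeMeasure ι p)) :
    ∫ x, g x * (F (Function.update x e true) - F x) ∂(cubeMeasure ι p) =
      (1 - p) * ∫ x, g (Function.update x e false) * discDeriv e F x ∂(cubeMeasure ι p) := by
  rw [← integral_resample e h, ← integral_const_mul]
  simp [resample, discDeriv]

lemma discDeriv_nonneg {F : (ι → Bool) → ℝ} (hF : Monotone F) (e : ι) (x : ι → Bool) :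
    0 ≤ discDeriv e F x :=
  sub_nonneg.2 (hF (update_le_update_iff'.2 (Bool.false_le _)))

lemma discDeriv_comp_update {e e' : ι} (h : e ≠ e') (g : (ι → Bool) → ℝ) (c : Bool)
    (x : ι → Bool) :
    discDeriv e (fun y => g (Function.update y e' c)) x =
      discDeriv e g (Function.update x e' c) := by
  simp only [discDeriv, Function.update_comm h]

lemma discDeriv_resample {e e' : ι} (h : e ≠ e') (g : (ι → Bool) → ℝ) (x : ι → Bool) :
    discDeriv e (resample p e' g) x = resample p e' (discDeriv e g) x := by
  simp only [discDeriv, resample, Function.update_comm h]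
  ring

lemma discDeriv_sub_resample_self (e : ι) (g : (ι → Bool) → ℝ) (x : ι → Bool) :
    discDeriv e (fun y => g y - resample p e g y) x = discDeriv e g x := by
  simp [discDeriv, resample]

lemma discDeriv_sub_resample {e e' : ι} (h : e ≠ e') (g : (ι → Bool) → ℝ) (x : ι → Bool) :
    discDeriv e (fun y => g y - resample p e' g y) x =
      discDeriv e g x - resample p e' (discDeriv e g) x := by
  rw [← discDeriv_resample h]
  simp only [discDeriv]
  ring

lemma abs_sub_resample_le (e : ι) (g : (ι → Bool) → ℝ) (x : ι → Bool) :
    |g x - resample p e g x| ≤ |discDeriv e g x| := by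
  have hx : Function.update x e (x e) = x := Function.update_eq_self e x
  cases hxe : x e <;> rw [hxe] at hx
  · rw [show g x - resample p e g x = -(p * discDeriv e g x) by
      simp only [resample, discDeriv, hx]; ring, abs_neg, abs_mul, abs_of_nonneg p.2.1]
    exact mul_le_of_le_one_left (abs_nonneg _) p.2.2
  · rw [show g x - resample p e g x = (1 - p) * discDeriv e g x by
      simp only [resample, discDeriv, hx]; ring, abs_mul, abs_of_nonneg (sub_nonneg.2 p.2.2)]
    exact mul_le_of_le_one_left (abs_nonneg _) (sub_le_self _ p.2.1)

lemma abs_resample_le (e : ι) (g : (ι → Bool) → ℝ) (x : ι → Bool) :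
    |resample p e g x| ≤ resample p e (fun y => |g y|) x := by
  refine (abs_add_le _ _).trans_eq ?_
  rw [abs_mul, abs_mul, abs_of_nonneg p.2.1, abs_of_nonneg (sub_nonneg.2 p.2.2), resample]

lemma dependsOn_comp_update {α : Type*} {e : ι} {s : Set ι} {g : (ι → Bool) → α}
    (hg : DependsOn g (insert e s)) (c : Bool) :
    DependsOn (fun x => g (Function.update x e c)) s := fun x y h => hg fun i hi => by
  obtain rfl | hie := eq_or_ne i e
  · simp
  · simpa [Function.update_of_ne hie] using h i (hi.resolve_left hie)

lemma dependsOn_resample {e : ι} {s : Set ι} {g : (ι → Bool) → ℝ}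
    (hg : DependsOn g (insert e s)) : DependsOn (resample p e g) s := fun x y h => by
  simp only [resample, dependsOn_comp_update hg false h, dependsOn_comp_update hg true h]

end Cube

section LogSobolev

lemma sq_mul_log_sq_le {M : ℝ} (hM : 0 < M) (s : ℝ) :
    s ^ 2 * Real.log (s ^ 2) ≤ s ^ 2 * Real.log M + s ^ 2 * (s ^ 2 / M - 1) := by
  rcases eq_or_ne s 0 with rfl | hs
  · simp
  have hs2 : 0 < s ^ 2 := by positivity
  have hlog := Real.log_le_sub_one_of_pos (div_pos hs2 hM)
  rw [Real.log_div hs2.ne' hM.ne'] at hlog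
  have := mul_le_mul_of_nonneg_left hlog hs2.le
  linarith

lemma two_point_entropy_le {p : ℝ} (hp0 : 0 ≤ p) (hp1 : p ≤ 1) (u v : ℝ) :
    (1 - p) * (u ^ 2 * Real.log (u ^ 2)) + p * (v ^ 2 * Real.log (v ^ 2)) -
      ((1 - p) * u ^ 2 + p * v ^ 2) * Real.log ((1 - p) * u ^ 2 + p * v ^ 2) ≤
      2 * (v - u) ^ 2 := by
  have hq := sub_nonneg.2 hp1
  have hu : 0 ≤ (1 - p) * u ^ 2 := by positivity
  have hv : 0 ≤ p * v ^ 2 := by positivity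
  rcases (add_nonneg hu hv).eq_or_lt with h0 | hM
  · have hu0 : (1 - p) * u ^ 2 = 0 := by linarith
    have hv0 : p * v ^ 2 = 0 := by linarith
    rw [← mul_assoc, ← mul_assoc, hu0, hv0]
    simpa using sq_nonneg (v - u)
  set M := (1 - p) * u ^ 2 + p * v ^ 2 with hMdef
  have : (1 - p) * (u ^ 2 * Real.log M) + p * (v ^ 2 * Real.log M) = M * Real.log M := by
    rw [hMdef]
    ring
  have hMvar : (1 - p) * (u ^ 2 * (u ^ 2 / M - 1)) + p * (v ^ 2 * (v ^ 2 / M - 1)) =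
      p * (1 - p) * (v + u) ^ 2 * (v - u) ^ 2 / M := by
    field_simp
    rw [hMdef]
    ring
  have hsum : p * (1 - p) * (v + u) ^ 2 ≤ 2 * M := by
    have hadd : (v + u) ^ 2 ≤ 2 * v ^ 2 + 2 * u ^ 2 := by nlinarith [sq_nonneg (v - u)]
    have := mul_le_mul_of_nonneg_left hadd (mul_nonneg hp0 hq)
    have := mul_nonneg hp0 hv
    have := mul_nonneg hq hu
    rw [hMdef]
    nlinarith
  have hle : p * (1 - p) * (v + u) ^ 2 * (v - u) ^ 2 / M ≤ 2 * (v - u) ^ 2 := by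
    rw [div_le_iff₀ hM]
    have := mul_le_mul_of_nonneg_right hsum (sq_nonneg (v - u))
    linarith
  have := mul_le_mul_of_nonneg_left (sq_mul_log_sq_le hM u) hq
  have := mul_le_mul_of_nonneg_left (sq_mul_log_sq_le hM v) hp0
  linarith

variable {ι : Type*} [Finite ι] [DecidableEq ι] {p : unitInterval}

lemma integral_cubeMeasure (e : ι) (g : (ι → Bool) → ℝ) :
    ∫ x, g x ∂(cubeMeasure ι p) =
      (1 - p) * ∫ x, g (Function.update x e false) ∂(cubeMeasure ι p) +
        p * ∫ x, g (Function.update x e true) ∂(cubeMeasure ι p) := by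
  rw [← integral_resample e .of_finite]
  simp only [resample]
  rw [integral_add .of_finite .of_finite, integral_const_mul, integral_const_mul]

/- Conditioning on the coordinate `e` splits the entropy into the entropies of the two halves
`g₀`, `g₁` and the entropy of the two-point function `c ↦ ‖g_c‖₂`; the latter is controlled by
the two-point inequality and `|‖g₁‖₂ - ‖g₀‖₂| ≤ ‖g₁ - g₀‖₂`. -/
lemma entropy_sq_cubeMeasure_le (e : ι) (g : (ι → Bool) → ℝ) :
    entropy (fun x => g x ^ 2) (cubeMeasure ι p) ≤
      (1 - p) * entropy (fun x => g (Function.update x e false) ^ 2) (cubeMeasure ι p) +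
        p * entropy (fun x => g (Function.update x e true) ^ 2) (cubeMeasure ι p) +
        2 * ∫ x, discDeriv e g x ^ 2 ∂(cubeMeasure ι p) := by
  have hsqrt := sq_sqrt_integral_sub_sqrt_integral_le (μ := cubeMeasure ι p)
    (.of_discrete : MemLp (fun x => g (Function.update x e true)) 2 _)
    (.of_discrete : MemLp (fun x => g (Function.update x e false)) 2 _)
  have htwo := two_point_entropy_le p.2.1 p.2.2
    √(∫ x, g (Function.update x e false) ^ 2 ∂(cubeMeasure ι p))
    √(∫ x, g (Function.update x e true) ^ 2 ∂(cubeMeasure ι p))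
  rw [Real.sq_sqrt (integral_nonneg fun _ => sq_nonneg _),
    Real.sq_sqrt (integral_nonneg fun _ => sq_nonneg _)] at htwo
  simp only [entropy, discDeriv]
  rw [integral_cubeMeasure e fun x => g x ^ 2,
    integral_cubeMeasure e fun x => g x ^ 2 * Real.log (g x ^ 2)]
  linarith

theorem entropy_sq_le_two_mul_sum_integral_discDeriv_sq {s : Finset ι} {g : (ι → Bool) → ℝ}
    (hg : DependsOn g (s : Set ι)) :
    entropy (fun x => g x ^ 2) (cubeMeasure ι p) ≤
      2 * ∑ e ∈ s, ∫ x, discDeriv e g x ^ 2 ∂(cubeMeasure ι p) := by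
  induction s using Finset.induction_on generalizing g with
  | empty =>
    obtain ⟨c, rfl⟩ : ∃ c, g = fun _ => c :=
      ⟨g fun _ => false, funext fun x => hg (by simp)⟩
    simp [entropy]
  | insert e s he ih =>
    rw [Finset.coe_insert] at hg
    have hsplit (e' : ι) (he' : e' ∈ s) : ∫ x, discDeriv e' g x ^ 2 ∂(cubeMeasure ι p) =
        (1 - p) * ∫ x, discDeriv e' (fun y => g (Function.update y e false)) x ^ 2
            ∂(cubeMeasure ι p) +
          p * ∫ x, discDeriv e' (fun y => g (Function.update y e true)) x ^ 2
            ∂(cubeMeasure ι p) := by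
      simp only [discDeriv_comp_update (ne_of_mem_of_not_mem he' he)]
      exact integral_cubeMeasure e _
    rw [Finset.sum_insert he, Finset.sum_congr rfl hsplit, Finset.sum_add_distrib,
      ← Finset.mul_sum, ← Finset.mul_sum]
    have h0 := mul_le_mul_of_nonneg_left (ih (dependsOn_comp_update hg false))
      (sub_nonneg.2 p.2.2)
    have h1 := mul_le_mul_of_nonneg_left (ih (dependsOn_comp_update hg true)) p.2.1
    have := entropy_sq_cubeMeasure_le (p := p) e g
    linarith

end LogSobolev

section FalikSamorodnitsky

variable {ι : Type*} [Finite ι] [DecidableEq ι] {p : unitInterval}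

lemma integral_resample_mul_resample (e : ι) (f g : (ι → Bool) → ℝ) :
    ∫ x, resample p e f x * resample p e g x ∂(cubeMeasure ι p) =
      ∫ x, f x * resample p e g x ∂(cubeMeasure ι p) := by
  rw [← integral_resample e (g := fun x => f x * resample p e g x) .of_finite]
  congr with x
  simp only [resample, Function.update_idem]
  ring

lemma integral_sq_sub_resample (e : ι) (g : (ι → Bool) → ℝ) :
    ∫ x, (g x - resample p e g x) ^ 2 ∂(cubeMeasure ι p) =
      ∫ x, g x ^ 2 ∂(cubeMeasure ι p) - ∫ x, resample p e g x ^ 2 ∂(cubeMeasure ι p) := by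
  have horth := integral_resample_mul_resample (p := p) e g g
  calc
    _ = ∫ x, (g x ^ 2 - 2 * (g x * resample p e g x) + resample p e g x * resample p e g x)
        ∂(cubeMeasure ι p) := by
      congr with x
      ring
    _ = _ := by
      rw [integral_add .of_finite .of_finite, integral_sub .of_finite .of_finite,
        integral_const_mul, ← horth]
      simp only [pow_two]
      ring

lemma integral_abs_resample_le (e : ι) (g : (ι → Bool) → ℝ) :
    ∫ x, |resample p e g x| ∂(cubeMeasure ι p) ≤ ∫ x, |g x| ∂(cubeMeasure ι p) := by
  rw [← integral_resample (p := p) e (g := fun x => |g x|) .of_finite]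
  exact integral_mono .of_finite .of_finite fun x => abs_resample_le e g x

/- The entropy of the square of the martingale increment `g - resample p e g` is bounded from
above by the log-Sobolev inequality and from below through its `L¹` norm. -/
lemma integral_sq_sub_resample_mul_one_add_log_le {s : Finset ι} {e : ι} (he : e ∉ s)
    {g : (ι → Bool) → ℝ} (hg : DependsOn g ((insert e s : Finset ι) : Set ι)) {r : ℝ}
    (hr : 0 < r) :
    (∫ x, (g x - resample p e g x) ^ 2 ∂(cubeMeasure ι p)) * (1 + Real.log r) ≤
      2 * (∫ x, discDeriv e g x ^ 2 ∂(cubeMeasure ι p) +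
        ∑ e' ∈ s, (∫ x, discDeriv e' g x ^ 2 ∂(cubeMeasure ι p) -
          ∫ x, discDeriv e' (resample p e g) x ^ 2 ∂(cubeMeasure ι p))) +
      r * (∫ x, |discDeriv e g x| ∂(cubeMeasure ι p)) ^ 2 := by
  have hdep : DependsOn (fun x => g x - resample p e g x) ((insert e s : Finset ι) : Set ι) := by
    intro x y h
    have hres := dependsOn_resample (p := p) (by rwa [Finset.coe_insert] at hg)
      fun i (hi : i ∈ (s : Set ι)) => h i (Finset.mem_insert_of_mem hi)
    simp only [hg h, hres]
  have hlower := integral_sq_mul_one_add_log_sub_le_entropy (μ := cubeMeasure ι p)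
    (V := fun x => g x - resample p e g x) .of_discrete .of_finite hr
  have hupper := entropy_sq_le_two_mul_sum_integral_discDeriv_sq (p := p) hdep
  have hsum (e' : ι) (he' : e' ∈ s) :
      ∫ x, discDeriv e' (fun y => g y - resample p e g y) x ^ 2 ∂(cubeMeasure ι p) =
        ∫ x, discDeriv e' g x ^ 2 ∂(cubeMeasure ι p) -
          ∫ x, discDeriv e' (resample p e g) x ^ 2 ∂(cubeMeasure ι p) := by
    have hne := ne_of_mem_of_not_mem he' he
    simp only [discDeriv_sub_resample hne, discDeriv_resample hne]
    exact integral_sq_sub_resample e _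
  rw [Finset.sum_insert he, Finset.sum_congr rfl hsum] at hupper
  simp only [discDeriv_sub_resample_self] at hupper
  have habs : ∫ x, |g x - resample p e g x| ∂(cubeMeasure ι p) ≤
      ∫ x, |discDeriv e g x| ∂(cubeMeasure ι p) :=
    integral_mono .of_finite .of_finite fun x => abs_sub_resample_le e g x
  have := mul_le_mul_of_nonneg_left
    (pow_le_pow_left₀ (integral_nonneg fun _ => abs_nonneg _) habs 2) hr.le
  linarith

theorem integral_sq_sub_sq_integral_mul_one_add_log_le {s : Finset ι} {g : (ι → Bool) → ℝ}
    (hg : DependsOn g (s : Set ι)) {r : ℝ} (hr : 0 < r) :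
    (∫ x, g x ^ 2 ∂(cubeMeasure ι p) - (∫ x, g x ∂(cubeMeasure ι p)) ^ 2) * (1 + Real.log r) ≤
      2 * ∑ e ∈ s, ∫ x, discDeriv e g x ^ 2 ∂(cubeMeasure ι p) +
        r * ∑ e ∈ s, (∫ x, |discDeriv e g x| ∂(cubeMeasure ι p)) ^ 2 := by
  induction s using Finset.induction_on generalizing g with
  | empty =>
    obtain ⟨c, rfl⟩ : ∃ c, g = fun _ => c :=
      ⟨g fun _ => false, funext fun x => hg (by simp)⟩
    simp
  | insert e s he ih =>
    have hincr := integral_sq_sub_resample_mul_one_add_log_le (p := p) he hg hr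
    rw [Finset.coe_insert] at hg
    have hres := ih (dependsOn_resample (p := p) hg)
    have hinfl : r * ∑ e' ∈ s, (∫ x, |discDeriv e' (resample p e g) x| ∂(cubeMeasure ι p)) ^ 2 ≤
        r * ∑ e' ∈ s, (∫ x, |discDeriv e' g x| ∂(cubeMeasure ι p)) ^ 2 := by
      refine mul_le_mul_of_nonneg_left (Finset.sum_le_sum fun e' he' =>
        pow_le_pow_left₀ (integral_nonneg fun _ => abs_nonneg _) ?_ 2) hr.le
      simp only [discDeriv_resample (ne_of_mem_of_not_mem he' he)]
      exact integral_abs_resample_le e _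
    rw [integral_sq_sub_resample, Finset.sum_sub_distrib] at hincr
    rw [integral_resample e .of_finite] at hres
    rw [Finset.sum_insert he, Finset.sum_insert he]
    linarith

lemma variance_mul_one_add_log_le [Fintype ι] (g : (ι → Bool) → ℝ) {r : ℝ} (hr : 0 < r) :
    Var[g; cubeMeasure ι p] * (1 + Real.log r) ≤
      2 * ∑ e, ∫ x, discDeriv e g x ^ 2 ∂(cubeMeasure ι p) +
        r * ∑ e, (∫ x, |discDeriv e g x| ∂(cubeMeasure ι p)) ^ 2 := by
  rw [variance_eq_sub .of_discrete]
  exact integral_sq_sub_sq_integral_mul_one_add_log_le (by simpa using dependsOn_univ g) hr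

end FalikSamorodnitsky

section SmallInfluences

variable {ι : Type*} [DecidableEq ι] {p : unitInterval}

lemma abs_discDeriv_exp_half_mul_le {F : (ι → Bool) → ℝ} {t : ℝ} {e : ι} {y : ι → Bool}
    (hD : 0 ≤ discDeriv e F y) (ht : |t| * discDeriv e F y ≤ 1) :
    |discDeriv e (fun y => Real.exp (t / 2 * F y)) y| ≤
      |t| * (Real.exp (t / 2 * F (Function.update y e false)) * discDeriv e F y) := by
  have habs : |t / 2 * discDeriv e F y| = |t| * discDeriv e F y / 2 := by
    rw [abs_mul, abs_div, abs_of_nonneg hD, abs_two]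
    ring
  have hexp := Real.abs_exp_sub_one_le (x := t / 2 * discDeriv e F y) (by linarith)
  have hfactor : discDeriv e (fun y => Real.exp (t / 2 * F y)) y =
      Real.exp (t / 2 * F (Function.update y e false)) *
        (Real.exp (t / 2 * discDeriv e F y) - 1) := by
    rw [mul_sub, ← Real.exp_add, discDeriv, discDeriv]
    ring_nf
  calc
    _ ≤ Real.exp (t / 2 * F (Function.update y e false)) * (2 * |t / 2 * discDeriv e F y|) := by
      rw [hfactor, abs_mul, Real.abs_exp]
      gcongr
    _ = _ := by
      rw [habs]
      ring

section Finite

variable [Finite ι] {F : (ι → Bool) → ℝ} {K δ t : ℝ} {e : ι}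

lemma integral_discDeriv_exp_half_mul_sq_le (hF : Monotone F) (hK : ∀ y, discDeriv e F y ≤ K)
    (ht : |t| * K ≤ 1) :
    ∫ y, discDeriv e (fun y => Real.exp (t / 2 * F y)) y ^ 2 ∂(cubeMeasure ι p) ≤
      t ^ 2 * K * ∫ y, Real.exp (t * F (Function.update y e false)) * discDeriv e F y
        ∂(cubeMeasure ι p) := by
  rw [← integral_const_mul]
  refine integral_mono .of_finite .of_finite fun y => ?_
  have hD := discDeriv_nonneg hF e y
  have hg := abs_discDeriv_exp_half_mul_le hD
    ((mul_le_mul_of_nonneg_left (hK y) (abs_nonneg t)).trans ht)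
  calc
    _ ≤ (|t| * (Real.exp (t / 2 * F (Function.update y e false)) * discDeriv e F y)) ^ 2 := by
      rw [← sq_abs]
      exact pow_le_pow_left₀ (abs_nonneg _) hg 2
    _ = t ^ 2 * discDeriv e F y *
        (Real.exp (t * F (Function.update y e false)) * discDeriv e F y) := by
      rw [mul_pow, mul_pow, sq_abs, exp_half_mul_sq]
      ring
    _ ≤ _ := by
      have := hK y
      gcongr

lemma sq_integral_abs_discDeriv_exp_half_mul_le (hF : Monotone F)
    (hK : ∀ y, discDeriv e F y ≤ K) (hδ : ∫ y, discDeriv e F y ∂(cubeMeasure ι p) ≤ δ)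
    (ht : |t| * K ≤ 1) :
    (∫ y, |discDeriv e (fun y => Real.exp (t / 2 * F y)) y| ∂(cubeMeasure ι p)) ^ 2 ≤
      t ^ 2 * δ * ∫ y, Real.exp (t * F (Function.update y e false)) * discDeriv e F y
        ∂(cubeMeasure ι p) := by
  have hD := discDeriv_nonneg hF e
  calc
    _ ≤ (|t| * ∫ y, Real.exp (t / 2 * F (Function.update y e false)) * discDeriv e F y
        ∂(cubeMeasure ι p)) ^ 2 := by
      rw [← integral_const_mul]
      exact pow_le_pow_left₀ (integral_nonneg fun _ => abs_nonneg _)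
        (integral_mono .of_finite .of_finite fun y => abs_discDeriv_exp_half_mul_le (hD y)
          ((mul_le_mul_of_nonneg_left (hK y) (abs_nonneg t)).trans ht)) 2
    _ ≤ t ^ 2 * ((∫ y, Real.exp (t / 2 * F (Function.update y e false)) ^ 2 * discDeriv e F y
        ∂(cubeMeasure ι p)) * ∫ y, discDeriv e F y ∂(cubeMeasure ι p)) := by
      rw [mul_pow, sq_abs]
      exact mul_le_mul_of_nonneg_left (sq_integral_mul_le_of_nonneg hD
        .of_discrete .of_finite .of_finite) (sq_nonneg t)
    _ ≤ t ^ 2 * ((∫ y, Real.exp (t * F (Function.update y e false)) * discDeriv e F y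
        ∂(cubeMeasure ι p)) * δ) := by
      simp only [exp_half_mul_sq]
      gcongr
      exact integral_nonneg fun y => mul_nonneg (Real.exp_nonneg _) (hD y)
    _ = _ := by ring

end Finite

variable [Fintype ι] {F : (ι → Bool) → ℝ} {S K δ : ℝ}

lemma one_sub_mul_sum_integral_mul_discDeriv_le
    (hS : ∀ y, ∑ e, (F (Function.update y e true) - F y) ≤ S) {h : (ι → Bool) → ℝ}
    (hh : ∀ y, 0 ≤ h y) :
    (1 - p) * ∑ e, ∫ y, h (Function.update y e false) * discDeriv e F y ∂(cubeMeasure ι p) ≤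
      S * ∫ y, h y ∂(cubeMeasure ι p) := by
  simp only [Finset.mul_sum, ← integral_mul_sub_update_true _ Integrable.of_finite]
  rw [← integral_finsetSum _ fun _ _ => .of_finite, ← integral_const_mul]
  refine integral_mono .of_finite .of_finite fun y => ?_
  simp only [← Finset.mul_sum]
  rw [mul_comm S]
  exact mul_le_mul_of_nonneg_left (hS y) (hh y)

lemma variance_exp_half_mul_le (hF : Monotone F) (hK0 : 0 ≤ K)
    (hδ0 : 0 ≤ δ) (hK : ∀ e y, discDeriv e F y ≤ K)
    (hS : ∀ y, ∑ e, (F (Function.update y e true) - F y) ≤ S)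
    (hδ : ∀ e, ∫ y, discDeriv e F y ∂(cubeMeasure ι p) ≤ δ) {t r : ℝ} (ht : |t| * K ≤ 1)
    (hr : 0 < r) :
    Var[fun y => Real.exp (t / 2 * F y); cubeMeasure ι p] * ((1 - p) * (1 + Real.log r)) ≤
      t ^ 2 * (S * (2 * K + r * δ)) * mgf F (cubeMeasure ι p) t := by
  set W : ι → ℝ := fun e =>
    ∫ y, Real.exp (t * F (Function.update y e false)) * discDeriv e F y ∂(cubeMeasure ι p)
  calc
    _ = (1 - p) * (Var[fun y => Real.exp (t / 2 * F y); cubeMeasure ι p] * (1 + Real.log r)) := by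
      ring
    _ ≤ (1 - p) * (2 * ∑ e, t ^ 2 * K * W e + r * ∑ e, t ^ 2 * δ * W e) := by
      refine mul_le_mul_of_nonneg_left ((variance_mul_one_add_log_le _ hr).trans ?_)
        (sub_nonneg.2 p.2.2)
      gcongr with e _ e
      · exact integral_discDeriv_exp_half_mul_sq_le hF (hK e) ht
      · exact sq_integral_abs_discDeriv_exp_half_mul_le hF (hK e) (hδ e) ht
    _ = t ^ 2 * (2 * K + r * δ) * ((1 - p) * ∑ e, W e) := by
      simp only [← Finset.mul_sum]
      ring
    _ ≤ t ^ 2 * (2 * K + r * δ) * (S * mgf F (cubeMeasure ι p) t) :=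
      mul_le_mul_of_nonneg_left
        (one_sub_mul_sum_integral_mul_discDeriv_le (h := fun y => Real.exp (t * F y)) hS
          fun _ => Real.exp_nonneg _) (by positivity)
    _ = _ := by ring

theorem measureReal_lt_abs_sub_integral_le_of_discDeriv_le (hp : (p : ℝ) < 1) (hF : Monotone F)
    (hK0 : 0 ≤ K) (hδ0 : 0 ≤ δ) (hK : ∀ e y, discDeriv e F y ≤ K)
    (hS : ∀ y, ∑ e, (F (Function.update y e true) - F y) ≤ S)
    (hδ : ∀ e, ∫ y, discDeriv e F y ∂(cubeMeasure ι p) ≤ δ) {k r θ : ℝ} (hk : 0 ≤ k)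
    (hr : 1 ≤ r)
    (hkr : S * (2 * K + r * δ) ≤ k * ((1 - p) * (1 + Real.log r)))
    (hθ : 0 ≤ θ) (hθK : θ * K ≤ 1) (hkθ : k * θ ^ 2 ≤ 1 / 2) (u : ℝ) :
    (cubeMeasure ι p).real {x | u < |F x - ∫ y, F y ∂(cubeMeasure ι p)|} ≤
      2 * Real.exp (2 - θ * u) := by
  have hq : 0 < (1 - p) * (1 + Real.log r) :=
    mul_pos (sub_pos.2 hp) (by linarith [Real.log_nonneg hr])
  have hvar (t : ℝ) (ht : |t| * K ≤ 1) :
      Var[fun y => Real.exp (t / 2 * F y); cubeMeasure ι p] ≤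
        k * t ^ 2 * mgf F (cubeMeasure ι p) t := by
    refine le_of_mul_le_mul_right ((variance_exp_half_mul_le hF hK0 hδ0 hK hS hδ ht
      (one_pos.trans_le hr)).trans ?_) hq
    have := mul_le_mul_of_nonneg_left hkr
      (mul_nonneg (sq_nonneg t) (mgf_nonneg : 0 ≤ mgf F (cubeMeasure ι p) t))
    linarith
  refine measureReal_lt_abs_sub_integral_le_two_mul_exp (fun t => .of_finite) hθ
    (fun t ht => ?_) u
  have hkt : k * t ^ 2 ≤ 1 / 2 := by rwa [← sq_abs, ht]
  have hcgf := cgf_le_of_variance_exp_half_mul_le (fun t => .of_finite) hk hkt fun s hs =>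
    hvar s ((mul_le_mul_of_nonneg_right (hs.trans ht.le) hK0).trans hθK)
  linarith

end SmallInfluences

section DependsOnFinset

variable {ι : Type*} {p : unitInterval} {s : Finset ι}

lemma measurable_of_dependsOn {α : Type*} [Nonempty α] [MeasurableSpace α] {g : (ι → Bool) → α}
    (hg : DependsOn g (s : Set ι)) : Measurable g := by
  obtain ⟨g', rfl⟩ := dependsOn_iff_exists_comp.1 hg
  exact (measurable_of_finite g').comp (by fun_prop)

lemma integrable_of_dependsOn {g : (ι → Bool) → ℝ} (hg : DependsOn g (s : Set ι)) :
    Integrable g (cubeMeasure ι p) := by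
  have hmeas := measurable_of_dependsOn hg
  obtain ⟨g', rfl⟩ := dependsOn_iff_exists_comp.1 hg
  obtain ⟨C, hC⟩ := (Set.finite_range fun z => |g' z|).bddAbove
  exact .of_bound hmeas.aestronglyMeasurable C (.of_forall fun x => hC ⟨_, rfl⟩)

lemma map_restrict_cubeMeasure : (cubeMeasure ι p).map s.restrict = cubeMeasure s p := by
  rw [cubeMeasure, cubeMeasure, Measure.infinitePi_map_restrict, Measure.infinitePi_eq_pi]

lemma extend_update [DecidableEq ι] (e : s) (z : s → Bool) (c : Bool) :
    Function.extend (↑) (Function.update z e c) (fun _ => false) =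
      Function.update (Function.extend ((↑) : s → ι) z fun _ => false) (e : ι) c := by
  ext i
  by_cases hi : i ∈ s
  · lift i to s using hi
    simp [Function.update_apply]
  · have hie : i ≠ e := fun h => hi (h ▸ e.2)
    simp [Function.update_of_ne hie, Function.extend_apply', hi]

lemma apply_extend_restrict {α : Type*} {g : (ι → Bool) → α} (hg : DependsOn g (s : Set ι))
    (x : ι → Bool) :
    g (Function.extend (↑) (s.restrict x) fun _ => false) = g x :=
  hg fun i hi => Subtype.val_injective.extend_apply _ _ (⟨i, hi⟩ : s)

lemma integral_apply_extend {g : (ι → Bool) → ℝ} (hg : DependsOn g (s : Set ι)) :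
    ∫ z, g (Function.extend ((↑) : s → ι) z fun _ => false) ∂(cubeMeasure s p) =
      ∫ x, g x ∂(cubeMeasure ι p) := by
  rw [← map_restrict_cubeMeasure, integral_map (by fun_prop)
    (measurable_of_finite _).aestronglyMeasurable]
  simp only [apply_extend_restrict hg]

lemma dependsOn_discDeriv [DecidableEq ι] {s : Set ι} {g : (ι → Bool) → ℝ} (hg : DependsOn g s)
    (e : ι) : DependsOn (discDeriv e g) s := fun x y h => by
  have hg' := hg.mono (Set.subset_insert e s)
  simp only [discDeriv, dependsOn_comp_update hg' false h, dependsOn_comp_update hg' true h]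

lemma integrable_update_true_sub [DecidableEq ι] {F : (ι → Bool) → ℝ}
    (hF : DependsOn F (s : Set ι)) (e : ι) :
    Integrable (fun x => F (Function.update x e true) - F x) (cubeMeasure ι p) := by
  have hF' : DependsOn F (insert e (s : Set ι)) := hF.mono (Set.subset_insert e _)
  exact (integrable_of_dependsOn (dependsOn_comp_update hF' true)).sub (integrable_of_dependsOn hF)

theorem measureReal_lt_abs_sub_integral_le_of_dependsOn [DecidableEq ι] {F : (ι → Bool) → ℝ}
    {S K δ : ℝ} (hFs : DependsOn F (s : Set ι)) (hp : (p : ℝ) < 1) (hF : Monotone F)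
    (hK0 : 0 ≤ K) (hδ0 : 0 ≤ δ) (hK : ∀ e y, discDeriv e F y ≤ K)
    (hS : ∀ y, ∑ e ∈ s, (F (Function.update y e true) - F y) ≤ S)
    (hδ : ∀ e, ∫ y, discDeriv e F y ∂(cubeMeasure ι p) ≤ δ) {k r θ : ℝ} (hk : 0 ≤ k)
    (hr : 1 ≤ r) (hkr : S * (2 * K + r * δ) ≤ k * ((1 - p) * (1 + Real.log r)))
    (hθ : 0 ≤ θ) (hθK : θ * K ≤ 1) (hkθ : k * θ ^ 2 ≤ 1 / 2) (u : ℝ) :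
    (cubeMeasure ι p).real {x | u < |F x - ∫ y, F y ∂(cubeMeasure ι p)|} ≤
      2 * Real.exp (2 - θ * u) := by
  set ext : (s → Bool) → ι → Bool := fun z => Function.extend (↑) z fun _ => false
  have hext_mono : Monotone ext := fun z w h => by
    refine Pi.le_def.2 fun i => ?_
    by_cases hi : i ∈ s
    · lift i to s using hi
      simpa [ext] using h i
    · simp [ext, Function.extend_apply', hi]
  have hderiv (e : s) (z : s → Bool) : discDeriv e (F ∘ ext) z = discDeriv (e : ι) F (ext z) := by
    simp only [discDeriv, Function.comp_apply, ext, extend_update]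
  have hint : ∫ z, (F ∘ ext) z ∂(cubeMeasure s p) = ∫ y, F y ∂(cubeMeasure ι p) :=
    integral_apply_extend hFs
  have hfin := measureReal_lt_abs_sub_integral_le_of_discDeriv_le (F := F ∘ ext) hp
    (hF.comp hext_mono) hK0 hδ0 (fun e z => (hderiv e z).trans_le (hK e _))
    (fun z => by
      simpa only [Function.comp_apply, ext, extend_update, Finset.sum_coe_sort s fun e =>
        F (Function.update (ext z) e true) - F (ext z)] using hS (ext z))
    (fun e => by
      simp only [hderiv]
      exact (integral_apply_extend (dependsOn_discDeriv hFs (e : ι))).trans_le (hδ e))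
    hk hr hkr hθ hθK hkθ u
  rw [hint, ← map_restrict_cubeMeasure,
    map_measureReal_apply (by fun_prop) (Set.toFinite _).measurableSet] at hfin
  simpa only [Set.preimage_ofPred_eq, Function.comp_apply, ext, apply_extend_restrict hFs]
    using hfin

end DependsOnFinset

section Lattice

variable {d : ℕ}

lemma l1Norm_neg (u : Fin d → ℤ) : l1Norm (-u) = l1Norm u := by
  simp [l1Norm]

lemma l1Norm_eq_zero {u : Fin d → ℤ} : l1Norm u = 0 ↔ u = 0 := by
  simp [l1Norm, funext_iff]

lemma natAbs_le_l1Norm (u : Fin d → ℤ) (i : Fin d) : (u i).natAbs ≤ l1Norm u :=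
  Finset.single_le_sum (f := fun i => (u i).natAbs) (fun _ _ => Nat.zero_le _) (Finset.mem_univ i)

lemma l1Norm_add_le (u v : Fin d → ℤ) : l1Norm (u + v) ≤ l1Norm u + l1Norm v := by
  rw [l1Norm, l1Norm, l1Norm, ← Finset.sum_add_distrib]
  exact Finset.sum_le_sum fun i _ => Int.natAbs_add_le _ _

lemma l1Norm_single (i : Fin d) (c : ℤ) : l1Norm (Pi.single i c) = c.natAbs := by
  rw [l1Norm, Finset.sum_eq_single i]
  · simp
  · intro j _ hj
    simp [hj]
  · simp

lemma l1Norm_add_single (u : Fin d → ℤ) (i : Fin d) (c : ℤ) :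
    l1Norm (u + Pi.single i c) + (u i).natAbs = l1Norm u + (u i + c).natAbs := by
  have hne : ∑ j ∈ Finset.univ.erase i, ((u + Pi.single i c : Fin d → ℤ) j).natAbs =
      ∑ j ∈ Finset.univ.erase i, (u j).natAbs :=
    Finset.sum_congr rfl fun j hj => by simp [Finset.ne_of_mem_erase hj]
  rw [l1Norm, l1Norm, ← Finset.add_sum_erase _ _ (Finset.mem_univ i),
    ← Finset.add_sum_erase _ (fun j => (u j).natAbs) (Finset.mem_univ i), hne, Pi.add_apply,
    Pi.single_eq_same]
  ring

lemma lattice_adj {u v : Fin d → ℤ} : (lattice d).Adj u v ↔ l1Norm (u - v) = 1 := Iff.rfl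

/-- Move one step towards `v` in a coordinate where `u` and `v` differ. -/
lemma exists_adj_l1Norm_sub_add_one {u v : Fin d → ℤ} (h : u ≠ v) :
    ∃ w, (lattice d).Adj u w ∧ l1Norm (w - v) + 1 = l1Norm (u - v) := by
  obtain ⟨i, hi⟩ := Function.ne_iff.1 h
  obtain ⟨c, hc, hstep⟩ : ∃ c : ℤ, c.natAbs = 1 ∧
      (u i - v i + c).natAbs + 1 = (u i - v i).natAbs := by
    rcases lt_or_gt_of_ne hi with hlt | hgt
    · exact ⟨1, rfl, by omega⟩
    · exact ⟨-1, rfl, by omega⟩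
  refine ⟨u + Pi.single i c, ?_, ?_⟩
  · rw [lattice_adj, sub_add_cancel_left, l1Norm_neg, l1Norm_single, hc]
  · have := l1Norm_add_single (u - v) i c
    rw [Pi.sub_apply] at this
    rw [add_sub_right_comm]
    omega

lemma exists_walk_length_eq_l1Norm (u v : Fin d → ℤ) :
    ∃ α : (lattice d).Walk u v, α.length = l1Norm (u - v) := by
  induction h : l1Norm (u - v) generalizing u with
  | zero =>
    obtain rfl := sub_eq_zero.1 (l1Norm_eq_zero.1 h)
    exact ⟨.nil, rfl⟩
  | succ n ih =>
    obtain ⟨w, hadj, hw⟩ := exists_adj_l1Norm_sub_add_one (u := u) (v := v) (by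
      rintro rfl
      rw [sub_self, l1Norm_eq_zero.2 rfl] at h
      omega)
    obtain ⟨α, hα⟩ := ih w (by omega)
    exact ⟨.cons hadj α, by rw [SimpleGraph.Walk.length_cons, hα]⟩

instance (u v : Fin d → ℤ) : Nonempty ((lattice d).Walk u v) :=
  (exists_walk_length_eq_l1Norm u v).nonempty

instance (u v : Fin d → ℤ) : Countable ((lattice d).Walk u v) :=
  Function.Injective.countable (f := fun α : (lattice d).Walk u v => α.support)
    fun _ _ => SimpleGraph.Walk.ext_support

noncomputable instance : (lattice d).LocallyFinite := fun u =>
  ((Set.finite_Icc (u - 1) (u + 1)).subset fun w (hw : l1Norm (u - w) = 1) => by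
    constructor <;> intro i <;> have := natAbs_le_l1Norm (u - w) i <;>
      simp only [Pi.sub_apply, Pi.add_apply, Pi.one_apply] at this ⊢ <;> omega).fintype

end Lattice

section WalkSplitting

variable {V : Type*} {G : SimpleGraph V}

lemma exists_append_first {u v : V} (α : G.Walk u v) (P : Set V) (h : ∃ w ∈ α.support, w ∈ P) :
    ∃ s ∈ P, ∃ (β : G.Walk u s) (γ : G.Walk s v), α = β.append γ ∧
      ∀ e ∈ β.edges, ∃ w ∈ e, w ∉ P := by
  induction α with
  | nil => exact ⟨_, by simpa using h, .nil, .nil, rfl, by simp⟩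
  | @cons u u' v hadj q ih =>
    by_cases hu : u ∈ P
    · exact ⟨u, hu, .nil, .cons hadj q, rfl, by simp⟩
    · obtain ⟨s, hs, β, γ, rfl, hβ⟩ := ih (by simpa [hu] using h)
      refine ⟨s, hs, .cons hadj β, γ, rfl, fun e he => ?_⟩
      rcases List.mem_cons.1 he with rfl | he
      · exact ⟨u, Sym2.mem_mk_left _ _, hu⟩
      · exact hβ e he

lemma exists_append_last {u v : V} (α : G.Walk u v) (P : Set V) (h : ∃ w ∈ α.support, w ∈ P) :
    ∃ t ∈ P, ∃ (β : G.Walk u t) (γ : G.Walk t v), α = β.append γ ∧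
      ∀ e ∈ γ.edges, ∃ w ∈ e, w ∉ P := by
  obtain ⟨t, ht, β, γ, hα, hβ⟩ := exists_append_first α.reverse P (by simpa using h)
  refine ⟨t, ht, γ.reverse, β.reverse, ?_, by simpa using hβ⟩
  rw [← SimpleGraph.Walk.reverse_append, ← hα, SimpleGraph.Walk.reverse_reverse]

lemma exists_append_append {u v : V} (α : G.Walk u v) (P : Set V)
    (h : ∃ w ∈ α.support, w ∈ P) :
    ∃ s ∈ P, ∃ t ∈ P, ∃ (β : G.Walk u s) (γ : G.Walk s t) (η : G.Walk t v),
      α = β.append (γ.append η) ∧ (∀ e ∈ β.edges, ∃ w ∈ e, w ∉ P) ∧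
        ∀ e ∈ η.edges, ∃ w ∈ e, w ∉ P := by
  obtain ⟨s, hs, β, γ, rfl, hβ⟩ := exists_append_first α P h
  obtain ⟨t, ht, γ, η, rfl, hη⟩ := exists_append_last γ P ⟨s, by simp, hs⟩
  exact ⟨s, hs, t, ht, β, γ, η, rfl, hβ, hη⟩

lemma mem_support_of_mem_edges {u v w : V} {α : G.Walk u v} {e : Sym2 V} (he : e ∈ α.edges)
    (hw : w ∈ e) : w ∈ α.support := by
  obtain ⟨w', rfl⟩ := Sym2.mem_iff_exists.1 hw
  exact α.fst_mem_support_of_mem_edges he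

end WalkSplitting

section PassageTime

variable {d : ℕ} {x y : Edge d → ℝ≥0} {u v : Fin d → ℤ}

lemma pathTime_append (x : Edge d → ℝ≥0) {u v w : Fin d → ℤ} (α : (lattice d).Walk u v)
    (β : (lattice d).Walk v w) : pathTime x (α.append β) = pathTime x α + pathTime x β := by
  simp [pathTime]

lemma pathTime_congr {α : (lattice d).Walk u v} (h : ∀ e : Edge d, e.1 ∈ α.edges → x e = y e) :
    pathTime x α = pathTime y α := by
  rw [pathTime, pathTime, List.map_congr_left fun e he => h ⟨e.edge, _⟩ (List.mem_map_of_mem he)]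

lemma pathTime_update_of_notMem (x : Edge d → ℝ≥0) {e : Edge d} (c : ℝ≥0)
    {α : (lattice d).Walk u v} (he : e.1 ∉ α.edges) :
    pathTime (Function.update x e c) α = pathTime x α :=
  pathTime_congr fun f hf => Function.update_of_ne (by rintro rfl; exact he hf) _ _

lemma pathTime_mono (h : x ≤ y) (α : (lattice d).Walk u v) : pathTime x α ≤ pathTime y α :=
  List.sum_le_sum fun _ _ => h _

lemma pathTime_const (c : ℝ≥0) (α : (lattice d).Walk u v) :
    pathTime (fun _ => c) α = c * α.length := by
  simp [pathTime, mul_comm]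

lemma pathTime_le {b : ℝ≥0} (hb : ∀ e, x e ≤ b) (α : (lattice d).Walk u v) :
    (pathTime x α : ℝ) ≤ b * α.length := by
  exact_mod_cast (pathTime_mono hb α).trans_eq (pathTime_const b α)

lemma le_pathTime {a : ℝ≥0} (ha : ∀ e, a ≤ x e) (α : (lattice d).Walk u v) :
    a * α.length ≤ (pathTime x α : ℝ) := by
  exact_mod_cast (pathTime_const a α).symm.trans_le (pathTime_mono ha α)

lemma measurable_pathTime (α : (lattice d).Walk u v) :
    Measurable fun x : Edge d → ℝ≥0 => pathTime x α := by
  induction α with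
  | nil => exact measurable_const
  | cons h q ih => exact (measurable_pi_apply _).add ih

lemma bddBelow_pathTime (x : Edge d → ℝ≥0) (u v : Fin d → ℤ) :
    BddBelow (Set.range fun α : (lattice d).Walk u v => (pathTime x α : ℝ)) :=
  ⟨0, Set.forall_mem_range.2 fun _ => NNReal.coe_nonneg _⟩

lemma passageTime_le_pathTime (x : Edge d → ℝ≥0) (α : (lattice d).Walk u v) :
    passageTime x u v ≤ pathTime x α :=
  ciInf_le (bddBelow_pathTime x u v) α

lemma passageTime_mono (h : x ≤ y) (u v : Fin d → ℤ) : passageTime x u v ≤ passageTime y u v :=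
  ciInf_mono (bddBelow_pathTime x u v) fun α => NNReal.coe_le_coe.2 (pathTime_mono h α)

lemma passageTime_le {b : ℝ≥0} (hb : ∀ e, x e ≤ b) (u v : Fin d → ℤ) :
    passageTime x u v ≤ b * l1Norm (u - v) := by
  obtain ⟨α, hα⟩ := exists_walk_length_eq_l1Norm u v
  rw [← hα]
  exact (passageTime_le_pathTime x α).trans (pathTime_le hb α)

lemma passageTime_le_of_mem {e : Edge d} {s t : Fin d → ℤ} (hs : s ∈ e.1) (ht : t ∈ e.1) :
    passageTime x s t ≤ x e := by
  obtain ⟨e, he⟩ := e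
  obtain ⟨w, rfl⟩ := Sym2.mem_iff_exists.1 hs
  rcases Sym2.mem_iff.1 ht with rfl | rfl
  · exact (passageTime_le_pathTime x .nil).trans (NNReal.coe_nonneg _)
  · exact (passageTime_le_pathTime x (.cons he .nil)).trans_eq (congrArg _ (add_zero (x _)))

lemma passageTime_triangle (x : Edge d → ℝ≥0) (u v w : Fin d → ℤ) :
    passageTime x u w ≤ passageTime x u v + passageTime x v w := by
  refine le_ciInf_add_ciInf fun α β => ?_
  rw [← NNReal.coe_add, ← pathTime_append]
  exact passageTime_le_pathTime x (α.append β)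

lemma measurable_passageTime (u v : Fin d → ℤ) :
    Measurable fun x : Edge d → ℝ≥0 => passageTime x u v :=
  Measurable.iInf fun α => (measurable_pathTime α).coe_nnreal_real

/-- A path through `e` can be rerouted so as to go through `e` at most once. -/
lemma passageTime_update_le (x : Edge d → ℝ≥0) (e : Edge d) (c : ℝ≥0) (u v : Fin d → ℤ) :
    passageTime (Function.update x e c) u v ≤ passageTime x u v + c := by
  set y := Function.update x e c with hy
  rw [← sub_le_iff_le_add]
  refine le_ciInf fun α => sub_le_iff_le_add.2 ?_
  by_cases he : e.1 ∈ α.edges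
  · obtain ⟨w, hw⟩ : ∃ w, w ∈ e.1 := ⟨_, e.1.out_fst_mem⟩
    obtain ⟨s, hs, t, ht, β, γ, η, rfl, hβ, hη⟩ :=
      exists_append_append α {w | w ∈ e.1} ⟨w, mem_support_of_mem_edges he hw, hw⟩
    have hβe : (pathTime y β : ℝ) = pathTime x β := by
      rw [hy, pathTime_update_of_notMem x c fun h => (hβ _ h).elim fun w hw => hw.2 hw.1]
    have hηe : (pathTime y η : ℝ) = pathTime x η := by
      rw [hy, pathTime_update_of_notMem x c fun h => (hη _ h).elim fun w hw => hw.2 hw.1]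
    have hst : passageTime y s t ≤ c :=
      (passageTime_le_of_mem hs ht).trans_eq (by rw [hy, Function.update_self])
    calc passageTime y u v
        ≤ passageTime y u s + (passageTime y s t + passageTime y t v) :=
          (passageTime_triangle y u s v).trans
            (add_le_add_right (passageTime_triangle y s t v) _)
      _ ≤ pathTime x β + (c + pathTime x η) := by
          rw [← hβe, ← hηe]
          gcongr <;> exact passageTime_le_pathTime y _
      _ ≤ pathTime x β + (c + pathTime x η) + pathTime x γ :=
          le_add_of_nonneg_right (NNReal.coe_nonneg _)
      _ = pathTime x (β.append (γ.append η)) + c := by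
          rw [pathTime_append, pathTime_append]
          push_cast
          ring
  · calc passageTime y u v ≤ pathTime y α := passageTime_le_pathTime y α
      _ = pathTime x α := by rw [hy, pathTime_update_of_notMem x c he]
      _ ≤ pathTime x α + c := le_add_of_nonneg_right (NNReal.coe_nonneg _)

end PassageTime

section Geodesic

variable {d : ℕ} {x : Edge d → ℝ≥0} {u v : Fin d → ℤ} {a b : ℝ≥0}

/-- A geodesic of the weights `x` is a path that realises the passage time between its ends. -/
def IsGeodesic (x : Edge d → ℝ≥0) {u v : Fin d → ℤ} (α : (lattice d).Walk u v) : Prop :=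
  (pathTime x α : ℝ) = passageTime x u v

lemma IsGeodesic.of_append_append {s t : Fin d → ℤ} {β : (lattice d).Walk u s}
    {γ : (lattice d).Walk s t} {η : (lattice d).Walk t v}
    (h : IsGeodesic x (β.append (γ.append η))) : IsGeodesic x γ := by
  refine le_antisymm (le_ciInf fun γ' => ?_) (passageTime_le_pathTime x γ)
  have := h.trans_le (passageTime_le_pathTime x (β.append (γ'.append η)))
  simp only [pathTime_append, NNReal.coe_add] at this
  linarith

lemma IsGeodesic.length_le {α : (lattice d).Walk u v} (hα : IsGeodesic x α) (ha : 0 < a)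
    (hax : ∀ e, a ≤ x e) (hxb : ∀ e, x e ≤ b) : (α.length : ℝ) ≤ b / a * l1Norm (u - v) := by
  rw [div_mul_eq_mul_div, le_div_iff₀ (by exact_mod_cast ha), mul_comm]
  exact (le_pathTime hax α).trans (hα.trans_le (passageTime_le hxb u v))

lemma exists_isGeodesic (ha : 0 < a) (hax : ∀ e, a ≤ x e) (u v : Fin d → ℤ) :
    ∃ α : (lattice d).Walk u v, IsGeodesic x α := by
  classical
  obtain ⟨α₀⟩ : Nonempty ((lattice d).Walk u v) := inferInstance
  have ha' : (0 : ℝ) < a := ha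
  obtain ⟨N, hN⟩ := exists_nat_gt ((pathTime x α₀ : ℝ) / a)
  rw [div_lt_iff₀ ha', mul_comm] at hN
  have hlt {α : (lattice d).Walk u v} (hα : pathTime x α ≤ pathTime x α₀) : α.length < N := by
    have : (a : ℝ) * α.length < a * N :=
      ((le_pathTime hax α).trans (NNReal.coe_le_coe.2 hα)).trans_lt hN
    exact_mod_cast lt_of_mul_lt_mul_left this ha'.le
  obtain ⟨α, -, hmin⟩ := Set.exists_min_image {α : (lattice d).Walk u v | α.length < N}
    (pathTime x) (Set.toFinite _) ⟨α₀, hlt le_rfl⟩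
  refine ⟨α, le_antisymm (le_ciInf fun β => NNReal.coe_le_coe.2 ?_)
    (passageTime_le_pathTime x α)⟩
  rcases le_total (pathTime x β) (pathTime x α₀) with hβ | hβ
  · exact hmin β (hlt hβ)
  · exact (hmin α₀ (hlt le_rfl)).trans hβ

lemma IsGeodesic.passageTime_update_le_of_notMem {α : (lattice d).Walk u v} (hα : IsGeodesic x α)
    {e : Edge d} (he : e.1 ∉ α.edges) (c : ℝ≥0) :
    passageTime (Function.update x e c) u v ≤ passageTime x u v := by
  rw [← hα, ← pathTime_update_of_notMem x c he]
  exact passageTime_le_pathTime _ α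

open Finset in
lemma card_filter_mem_edges_le_length (Z : Finset (Edge d))
    (α : (lattice d).Walk u v) : #{e ∈ Z | e.1 ∈ α.edges} ≤ α.length := by
  calc #{e ∈ Z | e.1 ∈ α.edges} ≤ #α.edges.toFinset :=
        card_le_card_of_injOn Subtype.val (fun e he => by simpa using (mem_filter.1 he).2)
          Subtype.val_injective.injOn
    _ ≤ α.edges.length := α.edges.toFinset_card_le
    _ = α.length := α.length_edges

open Finset in
lemma IsGeodesic.card_filter_mem_edges_le_of_diam
    {α : (lattice d).Walk u v} (hα : IsGeodesic x α) (ha : 0 < a) (hax : ∀ e, a ≤ x e)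
    (hxb : ∀ e, x e ≤ b) {Z : Finset (Edge d)} {P : Set (Fin d → ℤ)} {R : ℕ}
    (hZ : ∀ e ∈ Z, ∀ w ∈ e.1, w ∈ P) (hP : ∀ s ∈ P, ∀ t ∈ P, l1Norm (s - t) ≤ R) :
    (#{e ∈ Z | e.1 ∈ α.edges} : ℝ) ≤ b / a * R := by
  by_cases hvisit : ∃ w ∈ α.support, w ∈ P
  · obtain ⟨s, hs, t, ht, β, γ, η, rfl, hβ, hη⟩ := exists_append_append α P hvisit
    have hsub : {e ∈ Z | e.1 ∈ (β.append (γ.append η)).edges} ⊆ {e ∈ Z | e.1 ∈ γ.edges} := by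
      refine Finset.monotone_filter_right _ fun e heZ he => ?_
      simp only [SimpleGraph.Walk.edges_append, List.mem_append] at he
      rcases he with he | he | he
      · exact (hβ _ he).elim fun w hw => absurd (hZ e heZ w hw.1) hw.2
      · exact he
      · exact (hη _ he).elim fun w hw => absurd (hZ e heZ w hw.1) hw.2
    calc (#{e ∈ Z | e.1 ∈ (β.append (γ.append η)).edges} : ℝ)
        ≤ γ.length := by
          exact_mod_cast (card_le_card hsub).trans (card_filter_mem_edges_le_length Z γ)
      _ ≤ b / a * l1Norm (s - t) := hα.of_append_append.length_le ha hax hxb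
      _ ≤ b / a * R := by
          gcongr
          exact hP s hs t ht
  · have hempty : ({e ∈ Z | e.1 ∈ α.edges} : Finset (Edge d)) = ∅ :=
      filter_eq_empty_iff.2 fun e heZ he =>
        hvisit ⟨_, mem_support_of_mem_edges he e.1.out_fst_mem, hZ e heZ _ e.1.out_fst_mem⟩
    rw [hempty, card_empty, Nat.cast_zero]
    positivity

open Finset in
lemma IsGeodesic.sum_passageTime_update_sub_le {α : (lattice d).Walk u v}
    (hα : IsGeodesic x α) (Z : Finset (Edge d)) (c : ℝ≥0) :
    ∑ e ∈ Z, (passageTime (Function.update x e c) u v - passageTime x u v) ≤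
      c * #{e ∈ Z | e.1 ∈ α.edges} := by
  calc ∑ e ∈ Z, (passageTime (Function.update x e c) u v - passageTime x u v)
      ≤ ∑ e ∈ Z, (if e.1 ∈ α.edges then (c : ℝ) else 0) := by
        gcongr with e
        split_ifs with he
        · exact sub_le_iff_le_add'.2 (passageTime_update_le x e c u v)
        · exact sub_nonpos.2 (hα.passageTime_update_le_of_notMem he c)
    _ = c * #{e ∈ Z | e.1 ∈ α.edges} := by
        rw [← sum_filter, sum_const, nsmul_eq_mul, mul_comm]

end Geodesic

section CubeTime

variable {d : ℕ} {a b : ℝ≥0}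

/-- The edge weights with the value `b` on the edges marked `true` and `a` on the others, which
identify a `{a, b}`-valued configuration with a point of the cube. -/
def weights (a b : ℝ≥0) (x : Edge d → Bool) : Edge d → ℝ≥0 := fun e => if x e then b else a

/-- The first passage time of an `{a, b}`-valued configuration, as a function on the cube. -/
noncomputable def cubeTime (a b : ℝ≥0) (u v : Fin d → ℤ) (x : Edge d → Bool) : ℝ :=
  passageTime (weights a b x) u v

lemma weights_le (hab : a ≤ b) (x : Edge d → Bool) (e : Edge d) : weights a b x e ≤ b := by
  unfold weights
  split_ifs <;> simp [hab]

lemma le_weights (hab : a ≤ b) (x : Edge d → Bool) (e : Edge d) : a ≤ weights a b x e := by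
  unfold weights
  split_ifs <;> simp [hab]

lemma weights_mono (hab : a ≤ b) : Monotone (weights a b : (Edge d → Bool) → Edge d → ℝ≥0) := by
  intro x y hxy e
  cases hx : x e
  · simpa [weights, hx] using le_weights hab y e
  · simp [weights, hx, Bool.eq_true_of_true_le (hx ▸ hxy e)]

lemma weights_update_true (a b : ℝ≥0) (x : Edge d → Bool) (e : Edge d) :
    weights a b (Function.update x e true) = Function.update (weights a b x) e b := by
  ext f
  rcases eq_or_ne f e with rfl | hf
  · simp [weights]
  · simp [weights, hf]

lemma monotone_cubeTime (hab : a ≤ b) (u v : Fin d → ℤ) : Monotone (cubeTime a b u v) :=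
  fun _ _ hxy => passageTime_mono (weights_mono hab hxy) u v

lemma cubeTime_update_true_le (u v : Fin d → ℤ) (e : Edge d)
    (x : Edge d → Bool) :
    cubeTime a b u v (Function.update x e true) ≤ cubeTime a b u v x + b := by
  simpa only [cubeTime, weights_update_true] using passageTime_update_le (weights a b x) e b u v

lemma discDeriv_cubeTime_le (u v : Fin d → ℤ) (e : Edge d)
    (x : Edge d → Bool) : discDeriv e (cubeTime a b u v) x ≤ b := by
  have := cubeTime_update_true_le (a := a) (b := b) u v e (Function.update x e false)
  rw [Function.update_idem] at this
  exact sub_le_iff_le_add'.2 this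

lemma sum_cubeTime_update_true_sub_le (ha : 0 < a) (hab : a ≤ b)
    (u v : Fin d → ℤ) (x : Edge d → Bool) (Z : Finset (Edge d)) :
    ∑ e ∈ Z, (cubeTime a b u v (Function.update x e true) - cubeTime a b u v x) ≤
      b ^ 2 / a * l1Norm (u - v) := by
  obtain ⟨α, hα⟩ := exists_isGeodesic ha (le_weights hab x) u v
  have hlen := hα.length_le ha (le_weights hab x) (weights_le hab x)
  have hcard : ((Z.filter fun e => e.1 ∈ α.edges).card : ℝ) ≤ α.length := by
    exact_mod_cast card_filter_mem_edges_le_length Z α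
  simp only [cubeTime, weights_update_true]
  calc _ ≤ _ := hα.sum_passageTime_update_sub_le Z b
    _ ≤ b * (b / a * l1Norm (u - v)) := by gcongr; exact hcard.trans hlen
    _ = b ^ 2 / a * l1Norm (u - v) := by ring

/-- A geodesic spends little time in a set of small diameter. -/
lemma sum_cubeTime_update_true_sub_le_of_diam (ha : 0 < a) (hab : a ≤ b)
    (u v : Fin d → ℤ) (x : Edge d → Bool) {Z : Finset (Edge d)} {P : Set (Fin d → ℤ)} {R : ℕ}
    (hZ : ∀ e ∈ Z, ∀ w ∈ e.1, w ∈ P) (hP : ∀ s ∈ P, ∀ t ∈ P, l1Norm (s - t) ≤ R) :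
    ∑ e ∈ Z, (cubeTime a b u v (Function.update x e true) - cubeTime a b u v x) ≤
      b ^ 2 / a * R := by
  obtain ⟨α, hα⟩ := exists_isGeodesic ha (le_weights hab x) u v
  simp only [cubeTime, weights_update_true]
  calc _ ≤ _ := hα.sum_passageTime_update_sub_le Z b
    _ ≤ b * (b / a * R) := by
        gcongr
        exact hα.card_filter_mem_edges_le_of_diam ha (le_weights hab x) (weights_le hab x) hZ hP
    _ = b ^ 2 / a * R := by ring

lemma exists_dependsOn_cubeTime (ha : 0 < a) (hab : a ≤ b) (u v : Fin d → ℤ) :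
    ∃ s : Finset (Edge d), DependsOn (cubeTime a b u v) (s : Set (Edge d)) := by
  classical
  obtain ⟨N, hN⟩ := exists_nat_gt ((b : ℝ) / a * l1Norm (u - v))
  let s : Finset (Edge d) := (((lattice d).finsetWalkLengthLT N u v).biUnion fun α =>
    α.edges.toFinset).subtype (· ∈ (lattice d).edgeSet)
  have hle (x y : Edge d → Bool) (hxy : ∀ e ∈ s, x e = y e) :
      cubeTime a b u v y ≤ cubeTime a b u v x := by
    obtain ⟨α, hα⟩ := exists_isGeodesic ha (le_weights hab x) u v
    have hlen : α.length < N := by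
      exact_mod_cast (hα.length_le ha (le_weights hab x) (weights_le hab x)).trans_lt hN
    have hmem (e : Edge d) (he : e.1 ∈ α.edges) : e ∈ s := by
      refine Finset.mem_subtype.2 (Finset.mem_biUnion.2 ⟨α, ?_, List.mem_toFinset.2 he⟩)
      exact SimpleGraph.mem_finsetWalkLengthLT_iff.2 hlen
    calc cubeTime a b u v y ≤ pathTime (weights a b y) α := passageTime_le_pathTime _ α
      _ = pathTime (weights a b x) α := by
          rw [pathTime_congr (x := weights a b y) (y := weights a b x) fun e he => by
            rw [weights, weights, hxy e (hmem e he)]]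
      _ = cubeTime a b u v x := hα
  exact ⟨s, fun x y h => le_antisymm (hle y x fun e he => (h e he).symm) (hle x y h)⟩

end CubeTime

section Translation

variable {d : ℕ} {a b : ℝ≥0}

/-- The translation by `z` as an automorphism of the lattice. -/
def translation (z : Fin d → ℤ) : lattice d ≃g lattice d where
  toEquiv := Equiv.addRight z
  map_rel_iff' := by simp [lattice_adj]

/-- The translation by `z` of the edges of the lattice. -/
def edgeShift (z : Fin d → ℤ) : Edge d ≃ Edge d := (translation z).mapEdgeSet

lemma coe_edgeShift (z : Fin d → ℤ) (e : Edge d) : (edgeShift z e).1 = Sym2.map (· + z) e.1 := rfl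

lemma edgeShift_symm (z : Fin d → ℤ) : (edgeShift z).symm = edgeShift (-z) := by
  refine Equiv.ext fun e => (Equiv.symm_apply_eq _).2 (Subtype.ext ?_)
  rw [coe_edgeShift, coe_edgeShift, Sym2.map_map]
  simp

lemma mem_edgeShift {z w : Fin d → ℤ} {e : Edge d} : w ∈ (edgeShift z e).1 ↔ w - z ∈ e.1 := by
  simp [coe_edgeShift, Sym2.mem_map, ← eq_sub_iff_add_eq]

lemma edgeShift_left_injective (e : Edge d) : Function.Injective fun z => edgeShift z e := by
  obtain ⟨⟨u, w⟩, he⟩ := e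
  intro z z' hz
  have hz' : s(u + z, w + z) = s(u + z', w + z') := congrArg Subtype.val hz
  rcases Sym2.eq_iff.1 hz' with h | h
  · exact add_left_cancel h.1
  · ext i
    have hu : u i + z i = w i + z' i := congrFun h.1 i
    have hw : w i + z i = u i + z' i := congrFun h.2 i
    omega

lemma l1Norm_sub_le_one_of_mem {e : Edge d} {s t : Fin d → ℤ} (hs : s ∈ e.1) (ht : t ∈ e.1) :
    l1Norm (s - t) ≤ 1 := by
  obtain ⟨e, he⟩ := e
  obtain ⟨w, rfl⟩ := Sym2.mem_iff_exists.1 hs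
  rcases Sym2.mem_iff.1 ht with rfl | rfl
  · simp [l1Norm_eq_zero.2]
  · exact (lattice_adj.1 he).le

lemma pathTime_map_translation (y : Edge d → ℝ≥0) (z : Fin d → ℤ) {u v : Fin d → ℤ}
    (α : (lattice d).Walk u v) :
    pathTime y (α.map (translation z).toHom) = pathTime (y ∘ edgeShift z) α := by
  rw [pathTime, SimpleGraph.Walk.darts_map, List.map_map]
  rfl

lemma passageTime_add_le (y : Edge d → ℝ≥0) (z u v : Fin d → ℤ) :
    passageTime y (u + z) (v + z) ≤ passageTime (y ∘ edgeShift z) u v := by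
  refine le_ciInf fun α => ?_
  rw [← pathTime_map_translation]
  exact passageTime_le_pathTime y _

lemma passageTime_add (y : Edge d → ℝ≥0) (z u v : Fin d → ℤ) :
    passageTime y (u + z) (v + z) = passageTime (y ∘ edgeShift z) u v := by
  refine le_antisymm (passageTime_add_le y z u v) ?_
  have := passageTime_add_le (y ∘ edgeShift z) (-z) (u + z) (v + z)
  simpa [Function.comp_assoc, ← edgeShift_symm] using this

lemma cubeTime_add (z v : Fin d → ℤ) (x : Edge d → Bool) :
    cubeTime a b z (z + v) x = cubeTime a b 0 v (x ∘ edgeShift z) := by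
  have := passageTime_add (weights a b x) z 0 v
  rwa [zero_add, add_comm v z] at this

lemma integral_comp_edgeShift (p : unitInterval) (z : Fin d → ℤ) {g : (Edge d → Bool) → ℝ}
    (hg : Measurable g) :
    ∫ x, g (x ∘ edgeShift z) ∂(cubeMeasure (Edge d) p) = ∫ x, g x ∂(cubeMeasure (Edge d) p) := by
  conv_rhs => rw [← map_comp_equiv_cubeMeasure (edgeShift z)]
  have hmeas : Measurable fun (x : Edge d → Bool) i => x (edgeShift z i) := by fun_prop
  exact (integral_map hmeas.aemeasurable hg.aestronglyMeasurable).symm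

end Translation

section Averaging

open Finset
open scoped BigOperators

variable {d : ℕ} {a b : ℝ≥0} {B : Finset (Fin d → ℤ)} {R : ℕ}

/-- The passage time from `0` to `v`, averaged over the translates by the vectors of `B`. Its
influences are small when `B` is large, although it is close to the passage time itself. -/
noncomputable def avgTime (a b : ℝ≥0) (B : Finset (Fin d → ℤ)) (v : Fin d → ℤ)
    (x : Edge d → Bool) : ℝ :=
  𝔼 z ∈ B, cubeTime a b z (z + v) x

lemma exists_dependsOn_avgTime (ha : 0 < a) (hab : a ≤ b) (B : Finset (Fin d → ℤ))
    (v : Fin d → ℤ) : ∃ s : Finset (Edge d), DependsOn (avgTime a b B v) (s : Set (Edge d)) := by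
  choose s hs using fun z : Fin d → ℤ => exists_dependsOn_cubeTime ha hab z (z + v)
  refine ⟨B.biUnion s, fun x y h => expect_congr rfl fun z hz => hs z fun e he => h e ?_⟩
  exact mem_coe.2 (mem_biUnion.2 ⟨z, hz, he⟩)

lemma monotone_avgTime (hab : a ≤ b) (B : Finset (Fin d → ℤ)) (v : Fin d → ℤ) :
    Monotone (avgTime a b B v) :=
  fun _ _ hxy => expect_le_expect fun z _ => monotone_cubeTime hab z (z + v) hxy

lemma avgTime_update_true_sub (v : Fin d → ℤ) (e : Edge d) (x : Edge d → Bool) :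
    avgTime a b B v (Function.update x e true) - avgTime a b B v x =
      𝔼 z ∈ B, (cubeTime a b z (z + v) (Function.update x e true) - cubeTime a b z (z + v) x) :=
  (expect_sub_distrib _ _ _).symm

lemma discDeriv_avgTime_le (hB : B.Nonempty) (v : Fin d → ℤ) (e : Edge d) (x : Edge d → Bool) :
    discDeriv e (avgTime a b B v) x ≤ b := by
  rw [discDeriv, avgTime, avgTime, ← expect_sub_distrib]
  exact expect_le hB fun z _ => discDeriv_cubeTime_le z (z + v) e x

lemma sum_avgTime_update_true_sub_le (ha : 0 < a) (hab : a ≤ b) (hB : B.Nonempty)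
    (v : Fin d → ℤ) (x : Edge d → Bool) (Z : Finset (Edge d)) :
    ∑ e ∈ Z, (avgTime a b B v (Function.update x e true) - avgTime a b B v x) ≤
      b ^ 2 / a * l1Norm v := by
  simp only [avgTime_update_true_sub]
  rw [← expect_sum_comm]
  refine expect_le hB fun z _ => ?_
  have := sum_cubeTime_update_true_sub_le ha hab z (z + v) x Z
  rwa [sub_add_cancel_left, l1Norm_neg] at this

lemma abs_cubeTime_add_sub_le (hab : a ≤ b) (z v : Fin d → ℤ) (x : Edge d → Bool) :
    |cubeTime a b z (z + v) x - cubeTime a b 0 v x| ≤ 2 * b * l1Norm z := by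
  set y := weights a b x
  have hdist (u w : Fin d → ℤ) : passageTime y u w ≤ b * l1Norm (u - w) :=
    passageTime_le (weights_le hab x) u w
  have hz0 : passageTime y z 0 ≤ b * l1Norm z := by simpa using hdist z 0
  have h0z : passageTime y 0 z ≤ b * l1Norm z := by simpa [l1Norm_neg] using hdist 0 z
  have hv : passageTime y v (z + v) ≤ b * l1Norm z := by
    simpa [l1Norm_neg] using hdist v (z + v)
  have hv' : passageTime y (z + v) v ≤ b * l1Norm z := by simpa using hdist (z + v) v
  rw [cubeTime, cubeTime, abs_sub_le_iff]
  constructor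
  · linarith [passageTime_triangle y z 0 (z + v), passageTime_triangle y 0 v (z + v)]
  · linarith [passageTime_triangle y 0 z v, passageTime_triangle y z (z + v) v]

lemma abs_avgTime_sub_le (hab : a ≤ b) (hB : B.Nonempty) (hR : ∀ z ∈ B, l1Norm z ≤ R)
    (v : Fin d → ℤ) (x : Edge d → Bool) :
    |avgTime a b B v x - cubeTime a b 0 v x| ≤ 2 * b * R := by
  rw [avgTime, ← expect_const hB (cubeTime a b 0 v x), ← expect_sub_distrib]
  refine (abs_expect_le _ _).trans (expect_le hB fun z hz => ?_)
  refine (abs_cubeTime_add_sub_le hab z v x).trans ?_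
  gcongr
  exact hR z hz

/-- The translates of one edge by the vectors of `-B` lie in a set of small diameter, where a
geodesic spends little time. -/
lemma sum_cubeTime_update_edgeShift_neg_sub_le (ha : 0 < a) (hab : a ≤ b)
    (hR : ∀ z ∈ B, l1Norm z ≤ R) (v : Fin d → ℤ) (e : Edge d) (x : Edge d → Bool) :
    ∑ z ∈ B, (cubeTime a b 0 v (Function.update x (edgeShift (-z) e) true) -
      cubeTime a b 0 v x) ≤ b ^ 2 / a * (1 + 2 * R) := by
  have hinj : Function.Injective fun z => edgeShift (-z) e :=
    (edgeShift_left_injective e).comp neg_injective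
  have hdiam {w w' : Fin d → ℤ} (hw : ∃ z ∈ B, w + z ∈ e.1) (hw' : ∃ z ∈ B, w' + z ∈ e.1) :
      l1Norm (w - w') ≤ 1 + 2 * R := by
    obtain ⟨z, hz, hwz⟩ := hw
    obtain ⟨z', hz', hwz'⟩ := hw'
    calc l1Norm (w - w') = l1Norm ((w + z - (w' + z')) + (z' + -z)) := by congr 1; abel
      _ ≤ l1Norm (w + z - (w' + z')) + (l1Norm z' + l1Norm (-z)) :=
        (l1Norm_add_le _ _).trans (Nat.add_le_add_left (l1Norm_add_le _ _) _)
      _ ≤ 1 + (R + R) := by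
        rw [l1Norm_neg]
        gcongr
        exacts [l1Norm_sub_le_one_of_mem hwz hwz', hR z' hz', hR z hz]
      _ = 1 + 2 * R := by ring
  have := sum_cubeTime_update_true_sub_le_of_diam ha hab 0 v x
    (Z := B.image fun z => edgeShift (-z) e) (P := {w | ∃ z ∈ B, w + z ∈ e.1}) (R := 1 + 2 * R)
    (by
      intro e' he' w hw
      obtain ⟨z, hz, rfl⟩ := mem_image.1 he'
      exact ⟨z, hz, by simpa using mem_edgeShift.1 hw⟩)
    fun w hw w' hw' => hdiam hw hw'
  rw [sum_image hinj.injOn] at this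
  exact_mod_cast this

lemma integral_cubeTime_add_update_true_sub (ha : 0 < a) (hab : a ≤ b) (p : unitInterval)
    (z v : Fin d → ℤ) (e : Edge d) :
    ∫ x, (cubeTime a b z (z + v) (Function.update x e true) - cubeTime a b z (z + v) x)
      ∂(cubeMeasure (Edge d) p) =
    ∫ x, (cubeTime a b 0 v (Function.update x (edgeShift (-z) e) true) - cubeTime a b 0 v x)
      ∂(cubeMeasure (Edge d) p) := by
  obtain ⟨s, hs⟩ := exists_dependsOn_cubeTime ha hab (0 : Fin d → ℤ) v
  have hmeas : Measurable (cubeTime a b 0 v) := measurable_of_dependsOn hs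
  simp only [cubeTime_add, Function.update_comp_equiv, edgeShift_symm]
  exact integral_comp_edgeShift p z ((hmeas.comp measurable_update_left).sub hmeas)

lemma one_sub_mul_integral_discDeriv_avgTime_le (ha : 0 < a) (hab : a ≤ b) (p : unitInterval)
    (hR : ∀ z ∈ B, l1Norm z ≤ R) (v : Fin d → ℤ) (e : Edge d) :
    (1 - p) * ∫ x, discDeriv e (avgTime a b B v) x ∂(cubeMeasure (Edge d) p) ≤
      b ^ 2 / a * (1 + 2 * R) / #B := by
  obtain ⟨s, hs⟩ := exists_dependsOn_avgTime ha hab B v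
  have hint (z : Fin d → ℤ) := (exists_dependsOn_cubeTime ha hab z (z + v)).elim
    fun s hs => integrable_update_true_sub (p := p) hs e
  have hint₀ (f : Edge d) := (exists_dependsOn_cubeTime ha hab (0 : Fin d → ℤ) v).elim
    fun s hs => integrable_update_true_sub (p := p) hs f
  calc (1 - p) * ∫ x, discDeriv e (avgTime a b B v) x ∂(cubeMeasure (Edge d) p)
      = ∫ x, (avgTime a b B v (Function.update x e true) - avgTime a b B v x)
          ∂(cubeMeasure (Edge d) p) := by
        simpa using (integral_mul_sub_update_true (p := p) (g := 1) e
          (by simpa using integrable_update_true_sub hs e)).symm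
    _ = (∑ z ∈ B, ∫ x, (cubeTime a b 0 v (Function.update x (edgeShift (-z) e) true) -
          cubeTime a b 0 v x) ∂(cubeMeasure (Edge d) p)) / #B := by
        simp only [avgTime_update_true_sub, expect_eq_sum_div_card]
        rw [integral_div, integral_finsetSum _ fun z _ => hint z]
        simp only [integral_cubeTime_add_update_true_sub ha hab]
    _ ≤ b ^ 2 / a * (1 + 2 * R) / #B := by
        rw [← integral_finsetSum _ fun z _ => hint₀ _]
        gcongr
        refine (integral_mono (integrable_finsetSum _ fun z _ => hint₀ _)
          (integrable_const (b ^ 2 / a * (1 + 2 * R) : ℝ)) fun x =>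
            sum_cubeTime_update_edgeShift_neg_sub_le ha hab hR v e x).trans_eq ?_
        simp

end Averaging

section Box

open Finset

variable {d : ℕ} {a b : ℝ≥0} {p : unitInterval} {m : ℕ}

/-- The box `[0, m)^d` of translation vectors over which the passage time is averaged. -/
noncomputable def box (d m : ℕ) : Finset (Fin d → ℤ) :=
  Fintype.piFinset fun _ => Ico 0 (m : ℤ)

lemma card_box (d m : ℕ) : #(box d m) = m ^ d := by
  simp [box]

lemma box_nonempty (hm : 0 < m) : (box d m).Nonempty := by
  simp [← card_pos, card_box, hm]

lemma l1Norm_le_of_mem_box {z : Fin d → ℤ} (hz : z ∈ box d m) : l1Norm z ≤ d * m := by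
  have hcoord (i : Fin d) : (z i).natAbs ≤ m := by
    have := mem_Ico.1 (Fintype.mem_piFinset.1 hz i)
    omega
  simpa [l1Norm] using sum_le_card_nsmul univ _ m fun i _ => hcoord i

lemma integral_discDeriv_avgTime_box_le (hd : 2 ≤ d) (ha : 0 < a) (hab : a ≤ b)
    (hp : (p : ℝ) < 1) (hm : 0 < m) (v : Fin d → ℤ) (e : Edge d) :
    ∫ x, discDeriv e (avgTime a b (box d m) v) x ∂(cubeMeasure (Edge d) p) ≤
      b ^ 2 / a * (1 + 2 * d) / (1 - p) / m := by
  have hm₁ : (1 : ℝ) ≤ m := by exact_mod_cast hm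
  have hp' : 0 < 1 - (p : ℝ) := sub_pos.2 hp
  rw [div_right_comm, le_div_iff₀' hp']
  calc (1 - p) * ∫ x, discDeriv e (avgTime a b (box d m) v) x ∂(cubeMeasure (Edge d) p)
      ≤ b ^ 2 / a * (1 + 2 * (d * m : ℕ)) / #(box d m) :=
        one_sub_mul_integral_discDeriv_avgTime_le ha hab p (fun _ => l1Norm_le_of_mem_box) v e
    _ ≤ b ^ 2 / a * (m * (1 + 2 * d)) / m ^ 2 := by
        rw [card_box]
        push_cast
        gcongr
        linarith
    _ = b ^ 2 / a * (1 + 2 * d) / m := by field_simp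

/-- Averaging over the box of side `m` costs the error `2 * b * (d * m)`, and gains the factor
`1 + log m` because it makes the influences of order `1 / m`. -/
theorem exists_measureReal_cubeTime_le (hd : 2 ≤ d) (ha : 0 < a) (hab : a ≤ b)
    (hp : (p : ℝ) < 1) :
    ∃ D : ℝ, 0 < D ∧ ∀ (v : Fin d → ℤ) (m : ℕ) (θ u : ℝ), 0 < m → 0 ≤ θ → θ * b ≤ 1 →
      D * l1Norm v * θ ^ 2 ≤ 1 + Real.log m →
      (cubeMeasure (Edge d) p).real {x | u <
        |cubeTime a b 0 v x - ∫ y, cubeTime a b 0 v y ∂(cubeMeasure (Edge d) p)|} ≤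
        2 * Real.exp (2 - θ * (u - 2 * (2 * b * (d * m)))) := by
  have ha₀ : (0 : ℝ) < a := ha
  have hb₀ : (0 : ℝ) < b := ha₀.trans_le hab
  have hp' : 0 < 1 - (p : ℝ) := sub_pos.2 hp
  set C : ℝ := b ^ 2 / a * (1 + 2 * d) / (1 - p)
  have _ : 0 < C := by positivity
  refine ⟨2 * (b ^ 2 / a * (2 * b + C) / (1 - p)), by positivity,
    fun v m θ u hm hθ hθb hθm => ?_⟩
  have hm₀ : (0 : ℝ) < m := by exact_mod_cast hm
  have hm₁ : (1 : ℝ) ≤ m := by exact_mod_cast hm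
  have _ : 0 < 1 + Real.log m := by linarith [Real.log_nonneg hm₁]
  obtain ⟨s, hs⟩ := exists_dependsOn_avgTime ha hab (box d m) v
  obtain ⟨s', hs'⟩ := exists_dependsOn_cubeTime ha hab 0 v
  have hB : (box d m).Nonempty := box_nonempty hm
  have hclose (x : Edge d → Bool) :
      |avgTime a b (box d m) v x - cubeTime a b 0 v x| ≤ 2 * b * (d * m) := by
    exact_mod_cast abs_avgTime_sub_le hab hB (fun _ => l1Norm_le_of_mem_box) v x
  refine (measureReal_lt_abs_sub_integral_le (integrable_of_dependsOn hs')
    (integrable_of_dependsOn hs) hclose u).trans ?_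
  refine measureReal_lt_abs_sub_integral_le_of_dependsOn (r := m) (δ := C / m)
    (k := b ^ 2 / a * l1Norm v * (2 * b + C) / ((1 - p) * (1 + Real.log m))) hs hp
    (monotone_avgTime hab _ v) hb₀.le (by positivity) (discDeriv_avgTime_le hB v)
    (fun y => sum_avgTime_update_true_sub_le ha hab hB v y s)
    (integral_discDeriv_avgTime_box_le hd ha hab hp hm v) (by positivity) hm₁ ?_ hθ hθb ?_ _
  · rw [mul_div_cancel₀ _ hm₀.ne', div_mul_cancel₀ _ (by positivity)]
  · rw [div_mul_eq_mul_div, div_le_iff₀ (by positivity)]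
    have := mul_le_mul_of_nonneg_left hθm hp'.le
    field_simp at this ⊢
    linarith

end Box

section Concentration

variable {d : ℕ} {a b : ℝ≥0} {p : unitInterval}

lemma sqrt_sqrt_mul_sqrt_log_div_le {N : ℝ} (hN : 0 < N) :
    √(√N) * √(Real.log N / N) ≤ 2 := by
  have hlog : Real.log N ≤ 2 * √N := by
    linarith [Real.log_sqrt hN.le, Real.log_le_self (Real.sqrt_nonneg N)]
  rw [← Real.sqrt_mul (Real.sqrt_nonneg N)]
  refine Real.sqrt_le_iff.2 ⟨by norm_num, ?_⟩
  calc √N * (Real.log N / N) ≤ √N * (2 * √N / N) := by gcongr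
    _ = 2 * (√N * √N) / N := by ring
    _ = 2 := by rw [Real.mul_self_sqrt hN.le, mul_div_cancel_right₀ _ hN.ne']
    _ ≤ 2 ^ 2 := by norm_num

lemma exists_box_side {N : ℝ} (hN : 1 ≤ N) :
    ∃ m : ℕ, 0 < m ∧ Real.log N / 4 ≤ Real.log m ∧ m * √(Real.log N / N) ≤ 4 := by
  have hN₀ : 0 < N := by linarith
  have h₁ : 1 ≤ √(√N) := Real.one_le_sqrt.2 (Real.one_le_sqrt.2 hN)
  refine ⟨⌈√(√N)⌉₊, Nat.ceil_pos.2 (by linarith), ?_, ?_⟩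
  · calc Real.log N / 4 = Real.log √(√N) := by
          rw [Real.log_sqrt (Real.sqrt_nonneg N), Real.log_sqrt hN₀.le]
          ring
      _ ≤ Real.log ⌈√(√N)⌉₊ := Real.log_le_log (by linarith) (Nat.le_ceil _)
  · calc ⌈√(√N)⌉₊ * √(Real.log N / N) ≤ 2 * √(√N) * √(Real.log N / N) := by
          gcongr
          exact (Nat.ceil_lt_two_mul (by linarith)).le
      _ ≤ 4 := by linarith [sqrt_sqrt_mul_sqrt_log_div_le hN₀]

lemma exists_rate {β D : ℝ} (hβ : 0 ≤ β) (hD : 0 ≤ D) :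
    ∃ c : ℝ, 0 < c ∧ c * β ≤ 1 ∧ D * c ^ 2 ≤ 1 / 4 := by
  have h : 0 < 1 + β + 4 * D := by positivity
  refine ⟨(1 + β + 4 * D)⁻¹, by positivity, ?_, ?_⟩
  · rw [inv_mul_le_iff₀ h]
    linarith
  · rw [inv_pow, ← div_eq_mul_inv, div_le_iff₀ (by positivity)]
    nlinarith

theorem exists_measureReal_cubeTime_le_exp (hd : 2 ≤ d) (ha : 0 < a) (hab : a ≤ b)
    (hp : (p : ℝ) < 1) :
    ∃ C₁ C₂ : ℝ, 0 < C₁ ∧ 0 < C₂ ∧ ∀ v : Fin d → ℤ, 2 ≤ l1Norm v → ∀ t : ℝ,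
      (cubeMeasure (Edge d) p).real {x | t * √((l1Norm v : ℝ) / Real.log (l1Norm v)) <
        |cubeTime a b 0 v x - ∫ y, cubeTime a b 0 v y ∂(cubeMeasure (Edge d) p)|} ≤
        C₁ * Real.exp (-C₂ * t) := by
  obtain ⟨D, hD, htail⟩ := exists_measureReal_cubeTime_le hd ha hab hp
  obtain ⟨c, hc, hcb, hcD⟩ := exists_rate b.coe_nonneg hD.le
  refine ⟨2 * Real.exp (2 + 16 * (b * d * c)), c, by positivity, hc, fun v hv t => ?_⟩
  set N : ℝ := (l1Norm v : ℝ)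
  have hN : 2 ≤ N := Nat.ofNat_le_cast.2 hv
  set L := Real.log N
  have hL : 0 < L := Real.log_pos (by linarith)
  have hLN : L ≤ N := Real.log_le_self (by linarith)
  obtain ⟨m, hm, hLm, hmN⟩ := exists_box_side (N := N) (by linarith)
  have hθb : c * √(L / N) * b ≤ 1 := by
    have : √(L / N) ≤ 1 := Real.sqrt_le_one.2 (div_le_one_of_le₀ hLN (by linarith))
    calc c * √(L / N) * b ≤ c * 1 * b := by gcongr
      _ ≤ 1 := by rwa [mul_one]
  have hθm : D * N * (c * √(L / N)) ^ 2 ≤ 1 + Real.log m := by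
    calc D * N * (c * √(L / N)) ^ 2 = D * c ^ 2 * L := by
          rw [mul_pow, Real.sq_sqrt (by positivity)]
          field_simp
      _ ≤ 1 / 4 * L := by gcongr
      _ ≤ 1 + Real.log m := by linarith
  have hscale : √(L / N) * √(N / L) = 1 := by
    rw [← Real.sqrt_mul (by positivity), div_mul_div_cancel₀ (by positivity),
      div_self hL.ne', Real.sqrt_one]
  calc _ ≤ _ := htail v m (c * √(L / N)) (t * √(N / L)) hm (by positivity) hθb hθm
    _ = 2 * Real.exp (2 + 4 * (b * d * c) * (m * √(L / N)) -
          c * t * (√(L / N) * √(N / L))) := by ring_nf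
    _ ≤ 2 * Real.exp (2 + 4 * (b * d * c) * 4 - c * t) := by
        rw [hscale, mul_one]
        gcongr
    _ = 2 * Real.exp (2 + 16 * (b * d * c)) * Real.exp (-c * t) := by
        rw [mul_assoc 2 (Real.exp _), ← Real.exp_add]
        ring_nf

end Concentration

section BernoulliFPP

variable {d : ℕ} {a b : ℝ≥0}

lemma measurable_weights (a b : ℝ≥0) :
    Measurable (weights a b : (Edge d → Bool) → Edge d → ℝ≥0) :=
  measurable_pi_lambda _ fun e =>
    (measurable_of_finite fun c : Bool => if c then b else a).comp (measurable_pi_apply e)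

lemma map_weights_cubeMeasure (d : ℕ) (a b : ℝ≥0) (p : unitInterval) :
    (cubeMeasure (Edge d) p).map (weights a b) = bernoulliFPP d a b p := by
  have h := Measure.infinitePi_map_pi (ι := Edge d) (X := fun _ => Bool) (Y := fun _ => ℝ≥0)
    (fun _ => bernoulliMeasure true false p) (f := fun _ c => if c then b else a)
    (fun _ => measurable_of_finite _)
  simp only [map_bernoulliMeasure] at h
  exact h

lemma integrable_passageTime (ha : 0 < a) (hab : a ≤ b) (p : unitInterval) (u v : Fin d → ℤ) :
    Integrable (fun x => passageTime x u v) (bernoulliFPP d a b p) := by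
  rw [← map_weights_cubeMeasure,
    integrable_map_measure (measurable_passageTime u v).aestronglyMeasurable
      (measurable_weights a b).aemeasurable]
  obtain ⟨s, hs⟩ := exists_dependsOn_cubeTime (d := d) ha hab u v
  exact integrable_of_dependsOn hs

lemma measureReal_passageTime (p : unitInterval) (u v : Fin d → ℤ) (c : ℝ) :
    (bernoulliFPP d a b p).real {x | c <
        |passageTime x u v - ∫ y, passageTime y u v ∂(bernoulliFPP d a b p)|} =
      (cubeMeasure (Edge d) p).real {x | c <
        |cubeTime a b u v x - ∫ y, cubeTime a b u v y ∂(cubeMeasure (Edge d) p)|} := by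
  have hmeas := measurable_passageTime u v
  rw [← map_weights_cubeMeasure, integral_map (measurable_weights a b).aemeasurable
    hmeas.aestronglyMeasurable, map_measureReal_apply (measurable_weights a b)]
  · rfl
  · exact measurableSet_lt measurable_const (hmeas.sub_const _).norm

lemma bernoulliFPP_one (d : ℕ) (a b : ℝ≥0) :
    bernoulliFPP d a b 1 = Measure.dirac fun _ => b := by
  simp [bernoulliFPP]

lemma measureReal_dirac_lt_abs_sub_integral {Ω : Type*} [MeasurableSpace Ω] {f : Ω → ℝ}
    (hf : Measurable f) (x₀ : Ω) {u : ℝ} (hu : 0 ≤ u) :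
    (Measure.dirac x₀).real {x | u < |f x - ∫ y, f y ∂(Measure.dirac x₀)|} = 0 := by
  have hs : MeasurableSet {x | u < |f x - f x₀|} :=
    measurableSet_lt measurable_const (hf.sub_const _).norm
  rw [integral_dirac' _ _ hf.stronglyMeasurable, measureReal_def, Measure.dirac_apply' _ hs]
  simp [hu]

end BernoulliFPP

end FPP

theorem mainTheorem5 (d : ℕ) (hd : 2 ≤ d) (a b : ℝ≥0) (ha : 0 < a) (hab : a < b)
    (p : unitInterval) :
    ∃ C₁ C₂ : ℝ, 0 < C₁ ∧ 0 < C₂ ∧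
      ∀ v : Fin d → ℤ, 2 ≤ FPP.l1Norm v →
        Integrable (fun x => FPP.passageTime x 0 v) (FPP.bernoulliFPP d a b p) ∧
        ∀ t : ℝ, 0 < t →
          (FPP.bernoulliFPP d a b p).real
            {x | t * √((FPP.l1Norm v : ℝ) / Real.log (FPP.l1Norm v)) <
              |FPP.passageTime x 0 v -
                ∫ y, FPP.passageTime y 0 v ∂(FPP.bernoulliFPP d a b p)|}
            ≤ C₁ * Real.exp (-C₂ * t) := by
  have hint (v : Fin d → ℤ) := FPP.integrable_passageTime ha hab.le p 0 v
  rcases p.2.2.lt_or_eq with hp | hp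
  · obtain ⟨C₁, C₂, hC₁, hC₂, h⟩ := FPP.exists_measureReal_cubeTime_le_exp hd ha hab.le hp
    refine ⟨C₁, C₂, hC₁, hC₂, fun v hv => ⟨hint v, fun t _ => ?_⟩⟩
    rw [FPP.measureReal_passageTime]
    exact h v hv t
  · obtain rfl : p = 1 := Subtype.ext hp
    refine ⟨1, 1, one_pos, one_pos, fun v _ => ⟨hint v, fun t ht => ?_⟩⟩
    rw [FPP.bernoulliFPP_one, FPP.measureReal_dirac_lt_abs_sub_integral
      (FPP.measurable_passageTime 0 v) _ (by positivity)]
    positivity
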